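/- Let $T>0$, let $(\Omega,\mathcal F,P)$ be a complete probability space with a filtration $\{\mathcal F_t\}_{t\in[0,T]}$ satisfying the usual conditions, and let $\tilde S=\{\tilde S(t)\}_{t\in[0,T]}$ (the discounted stock prices) be a continuous adapted process with values in $\mathbb R^d_{++}=(0,\infty)^d$ and with a deterministic starting point $\tilde S(0)=s$. Assume that $\tilde S$ has conditional full support: for every $t\in[0,T)$, almost surely, the support of the $\mathcal F_t$-conditional law of the path $\tilde S|_{[t,T]}$, as a random element of the space $C^+([t,T];\mathbb R^d)$ of continuous functions $[t,T]\to\mathbb R^d_{++}$ with the uniform topology, is the set of all $f\in C^+([t,T];\mathbb R^d)$ with $f(t)=\tilde S(t)$. For $\epsilon>0$, an absolutely continuous $\epsilon$-consistent price system is a pair $(\hat S,Q)$ of a probability measure $Q\ll P$ on $(\Omega,\mathcal F)$ and a $Q$-martingale $\hat S=\{\hat S(t)\}_{t\in[0,T]}$ with respect to $\{\mathcal F_t\}$, with values in $\mathbb R^d_{++}$ and with $Q$-a.s. càdlàg paths, such that $Q$-a.s. $$1-\epsilon<\frac{\tilde S_i(t)}{\hat S_i(t)}<1+\epsilon\qquad\text{for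 all } t\in[0,T],\ i=1,\dots,d.$$ Let $N\ge 1$ be an integer, let $\epsilon>0$, and let $M=\{M(k)\}_{k=0}^N$ be a martingale (in its own filtration, on an arbitrary probability space) that takes finitely many values, all in $\mathbb R^d_{++}$, and satisfies: 1. $M(0)=s$ a.s.; 2. for every $k<N$, almost surely, the conditional law of $M(k+1)-M(k)$ given $M(0),\dots,M(k)$ is atomic with exactly $d+1$ atoms, and $0$ lies in the interior of the convex hull of its support; 3. for every $k<N$ and $i=1,\dots,d$, $(1-\epsilon/3)M_i(k)<M_i(k+1)<(1+\epsilon/3)M_i(k)$ a.s. Then there exists an absolutely continuous $\epsilon$-consistent price system $(\hat S,Q)$ such that the law of $\{\hat S(kT/N)\}_{k=0}^N$ under $Q$ equals the law of $\{M(k)\}_{k=0}^N$ and such that, for every $k<N$, $Q$-a.s. the conditional law under $Q$ of $\hat S((k+1)T/N)$ given $\mathcal F_{kT/N}$ equals its conditional law under $Q$ given $\hat S(0),\hat S(T/N),\dots,\hat S(kT/N)$. -/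

import Mathlib

open MeasureTheory ProbabilityTheory Filter
open scoped Topology

/-- The open positive orthant of `ℝ^d`, the state space of the discounted stock prices. -/
abbrev Orthant (d : ℕ) : Type := {x : Fin d → ℝ // ∀ i, 0 < x i}

/-- The trading period `[0, T]`. -/
abbrev TimeInterval (T : ℝ) : Type := Set.Icc (0 : ℝ) T

/-- The space of continuous functions from `[t, T]` to the open positive orthant. The topology
is Mathlib's compact-open topology, which is the uniform topology since `[t, T]` is compact. -/
abbrev PathSpace (d : ℕ) {T : ℝ} (t : TimeInterval T) : Type := C(Set.Ici t, Orthant d)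

instance Orthant.instNonempty (d : ℕ) : Nonempty (Orthant d) :=
  ⟨⟨fun _ => 1, fun _ => one_pos⟩⟩

instance Orthant.instPolishSpace (d : ℕ) : PolishSpace (Orthant d) := by
  have h : IsOpen {x : Fin d → ℝ | ∀ i, 0 < x i} := by
    simp only [Set.ofPred_forall]
    exact isOpen_iInter_of_finite fun i => isOpen_lt continuous_const (continuous_apply i)
  exact h.polishSpace

instance TimeInterval.instCompactSpaceIci {T : ℝ} (t : TimeInterval T) :
    CompactSpace (Set.Ici t) :=
  isCompact_iff_compactSpace.mp isClosed_Ici.isCompact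

instance PathSpace.instMeasurableSpace (d : ℕ) {T : ℝ} (t : TimeInterval T) :
    MeasurableSpace (PathSpace d t) := borel _

instance PathSpace.instBorelSpace (d : ℕ) {T : ℝ} (t : TimeInterval T) :
    BorelSpace (PathSpace d t) := ⟨rfl⟩

theorem ContinuousMap.polishSpace_of_compact (X Y : Type*) [TopologicalSpace X]
    [CompactSpace X] [LocallyCompactSpace X] [SecondCountableTopology X] [TopologicalSpace Y]
    [PolishSpace Y] : PolishSpace C(X, Y) := by
  let := TopologicalSpace.upgradeIsCompletelyMetrizable Y
  have : TopologicalSpace.IsCompletelyMetrizableSpace C(X, Y) := inferInstance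
  exact { }

instance PathSpace.instPolishSpace (d : ℕ) {T : ℝ} (t : TimeInterval T) :
    PolishSpace (PathSpace d t) :=
  ContinuousMap.polishSpace_of_compact _ _

instance PathSpace.instNonempty (d : ℕ) {T : ℝ} (t : TimeInterval T) :
    Nonempty (PathSpace d t) :=
  ⟨ContinuousMap.const _ (Classical.arbitrary _)⟩

noncomputable section

/-- The usual conditions: the filtration is right-continuous and each of its members contains
all `P`-null sets. -/
structure UsualConditions {Ω : Type*} {mΩ : MeasurableSpace Ω} (P : Measure Ω) {T : ℝ}
    (ℱ : Filtration (TimeInterval T) mΩ) : Prop where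
  rightContinuous : ℱ.IsRightContinuous
  null_measurable : ∀ (t : TimeInterval T) (A : Set Ω), P A = 0 → MeasurableSet[ℱ t] A

/-- The regular conditional distribution of the random element `Y` given the
sub-σ-algebra `m`, as a Markov kernel from `(Ω, m)`. -/
def condLaw {Ω E : Type*} {mΩ : MeasurableSpace Ω} [MeasurableSpace E] [StandardBorelSpace E]
    [Nonempty E] (P : Measure Ω) [IsFiniteMeasure P] (m : MeasurableSpace Ω) (Y : Ω → E) :
    @Kernel Ω E m _ :=
  @condDistrib Ω Ω E _ _ _ mΩ m Y id P _

/-- The restriction to `[t, T]` of the path of a continuous process. -/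
def restrictPath {Ω : Type*} {d : ℕ} {T : ℝ} (S : TimeInterval T → Ω → Orthant d)
    (hS : ∀ ω, Continuous fun u => S u ω) (t : TimeInterval T) (ω : Ω) : PathSpace d t :=
  ⟨fun u => S u.1 ω, (hS ω).comp continuous_subtype_val⟩

/-- Conditional full support: for every `t < T`, almost surely, the support of the conditional
law of `S` restricted to `[t, T]` given `ℱ t` consists of all continuous paths in the open
positive orthant that start at time `t` from the point `S t`. -/
def ConditionalFullSupport {Ω : Type*} {mΩ : MeasurableSpace Ω} (P : Measure Ω)
    [IsFiniteMeasure P] {d : ℕ} {T : ℝ} (ℱ : Filtration (TimeInterval T) mΩ)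
    (S : TimeInterval T → Ω → Orthant d) (hS : ∀ ω, Continuous fun u => S u ω) : Prop :=
  ∀ t : TimeInterval T, (t : ℝ) < T → ∀ᵐ ω ∂P,
    (condLaw P (ℱ t) (restrictPath S hS t) ω).support =
      {f : PathSpace d t | f ⟨t, Set.self_mem_Ici⟩ = S t ω}

/-- Right-continuous with left limits. -/
def IsCadlag {T : ℝ} {E : Type*} [TopologicalSpace E] (f : TimeInterval T → E) : Prop :=
  ∀ t, ContinuousWithinAt f (Set.Ici t) t ∧ ∃ l, Tendsto f (𝓝[<] t) (𝓝 l)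

/-- `(Shat, Q)` is an absolutely continuous `ε`-consistent price system for `S`. As usual for
martingales in continuous time, the paths of `Shat` are càdlàg (`Q`-almost surely). -/
structure IsConsistentPriceSystem {Ω : Type*} {mΩ : MeasurableSpace Ω} (P : Measure Ω)
    {d : ℕ} {T : ℝ} (ℱ : Filtration (TimeInterval T) mΩ)
    (S : TimeInterval T → Ω → Orthant d) (ε : ℝ)
    (Shat : TimeInterval T → Ω → Fin d → ℝ) (Q : Measure Ω) : Prop where
  isProbabilityMeasure : IsProbabilityMeasure Q
  absolutelyContinuous : Q ≪ P
  martingale : Martingale Shat ℱ Q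
  cadlag : ∀ᵐ ω ∂Q, IsCadlag fun t => Shat t ω
  pos : ∀ t ω i, 0 < Shat t ω i
  close : ∀ᵐ ω ∂Q, ∀ t i,
    1 - ε < (S t ω : Fin d → ℝ) i / Shat t ω i ∧ (S t ω : Fin d → ℝ) i / Shat t ω i < 1 + ε

/-- The initial segment `(X 0, …, X k)` of a discrete time process. -/
def history {Ω E : Type*} {N : ℕ} (X : Fin (N + 1) → Ω → E) (k : Fin (N + 1)) (ω : Ω) :
    Set.Iic k → E :=
  fun j => X j ω

/-- The discrete martingales to be embedded: finite valued martingales (in their own filtration)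
with values in the open positive orthant, started at `s`, such that the conditional law of each
increment given the past is carried by exactly `d + 1` points whose convex hull contains `0` in
its interior, and with relative steps smaller than `ε / 3`. -/
structure IsAdmissibleMartingale {Ω : Type*} {mΩ : MeasurableSpace Ω} (μ : Measure Ω)
    [IsFiniteMeasure μ] {d N : ℕ} (s : Fin d → ℝ) (ε : ℝ)
    (M : Fin (N + 1) → Ω → Fin d → ℝ) : Prop where
  stronglyMeasurable : ∀ k, StronglyMeasurable (M k)
  finite_range : ∀ k, (Set.range (M k)).Finite
  pos : ∀ k ω i, 0 < M k ω i
  martingale : Martingale M (Filtration.natural M stronglyMeasurable) μ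
  init : ∀ᵐ ω ∂μ, M 0 ω = s
  ncard_support : ∀ k : Fin N, ∀ᵐ ω ∂μ,
    (condDistrib (fun ω => M k.succ ω - M k.castSucc ω) (history M k.castSucc) μ
      (history M k.castSucc ω)).support.ncard = d + 1
  zero_mem : ∀ k : Fin N, ∀ᵐ ω ∂μ,
    (0 : Fin d → ℝ) ∈ interior (convexHull ℝ
      (condDistrib (fun ω => M k.succ ω - M k.castSucc ω) (history M k.castSucc) μ
        (history M k.castSucc ω)).support)
  step : ∀ (k : Fin N) (i : Fin d), ∀ᵐ ω ∂μ,
    (1 - ε / 3) * M k.castSucc ω i < M k.succ ω i ∧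
      M k.succ ω i < (1 + ε / 3) * M k.castSucc ω i

/-- The grid point `kT/N` of `[0, T]`. -/
def gridTime {T : ℝ} (hT : 0 < T) (N : ℕ) (k : Fin (N + 1)) : TimeInterval T :=
  ⟨k * T / N, by
    have hk : (k : ℝ) ≤ N := by exact_mod_cast Nat.lt_succ_iff.mp k.isLt
    refine ⟨by positivity, div_le_of_le_mul₀ (by positivity) hT.le ?_⟩
    nlinarith⟩

end

/-! ### Upcrossings and one-sided limits along a countable set of times -/

section Regularization

variable {α : Type*} [LinearOrder α]

/-! The values of `M` form a finite set of states. To each state one attaches bounds `[l, u]`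
containing every value that `M` can take one step later, and the open convex box `U` with sides `((1
- ε) u, (1 + ε) l)`. If `S` is in `U` while the shadow price is in `[l, u]`, their ratio is within
`ε` of 1. The step bound `ε / 3` leaves enough room for such boxes to contain points representing
the current state and all its successors (`exists_targets`). Small disjoint targets `V ⊆ U` around
these points make the state readable from the position of `S` at a grid time.

Conditional full support allows `S` to be steered. Given the past at a grid time, with `S` in the
target of the current state, the event that `S` stays in the current tube and ends in the target of
a possible next state has conditional probability `g > 0`. Multiplying the density by `p / g` on
this event gives it the prescribed conditional probability `p` (`exists_change_of_measure`). With
`p` the transition probabilities of `M`, iteration (`IsEmbedding.succ`) yields `Q ≪ P` under which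
the state `J k` read at the `k`-th grid time has the law of `M`, its next value depending on the
past of the big filtration only through `J 0, …, J k`.

The price system is the càdlàg version of the `Q`-martingale closed by the value of the last state.
At grid times it equals the value of `J k`, because the embedded chain is a martingale for the big
filtration. Between grid times it is a conditional mean of the next value, which lies in a box
already known, so it stays in that box; the tube then controls the ratio. The càdlàg version comes
from the upcrossing inequality along a dense sequence of times and right-continuity of the
filtration (`exists_cadlag_version`). -/

theorem Finset.exists_monotone_subset_range (F : Finset α) (hF : F.Nonempty) :
    ∃ g : ℕ → α, Monotone g ∧ (F : Set α) ⊆ Set.range g := by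
  have hpos : 0 < F.card := hF.card_pos
  refine ⟨fun n => F.orderEmbOfFin rfl ⟨min n (F.card - 1), by omega⟩, ?_, ?_⟩
  · intro i j hij
    refine (F.orderEmbOfFin rfl).monotone ?_
    simp only [Fin.mk_le_mk]
    omega
  · intro x hx
    have : x ∈ Set.range (F.orderEmbOfFin rfl) := by
      rw [Finset.range_orderEmbOfFin]; exact hx
    obtain ⟨i, rfl⟩ := this
    refine ⟨i, ?_⟩
    have hi : min (i : ℕ) (F.card - 1) = i := by omega
    simp [hi]

/-- `AltChain D y a b n l r`: strictly between `l` and `r` there is an increasing chain of `2 n`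
points of `D` at which `y` is alternately below `a` and above `b`. -/
def AltChain (D : Set α) (y : α → ℝ) (a b : ℝ) : ℕ → α → α → Prop
  | 0, l, r => l < r
  | n + 1, l, r => ∃ s ∈ D, ∃ t ∈ D, AltChain D y a b n l s ∧ s < t ∧ t < r ∧ y s < a ∧ b < y t

theorem AltChain.mono_right {D : Set α} {y : α → ℝ} {a b : ℝ} {n : ℕ} {l r r' : α}
    (h : AltChain D y a b n l r) (hr : r ≤ r') : AltChain D y a b n l r' := by
  cases n with
  | zero => exact lt_of_lt_of_le h hr
  | succ n =>
    obtain ⟨s, hs, t, ht, h1, h2, h3, h4⟩ := h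
    exact ⟨s, hs, t, ht, h1, h2, h3.trans_le hr, h4⟩

theorem AltChain.prepend {D : Set α} {y : α → ℝ} {a b : ℝ} {n : ℕ} {l s t l' r : α}
    (hs : s ∈ D) (ht : t ∈ D) (hls : l < s) (hst : s < t) (htl : t < l') (hys : y s < a)
    (hyt : b < y t) (h : AltChain D y a b n l' r) : AltChain D y a b (n + 1) l r := by
  induction n generalizing r with
  | zero => exact ⟨s, hs, t, ht, hls, hst, htl.trans h, hys, hyt⟩
  | succ n ih =>
    obtain ⟨s', hs', t', ht', h1, h2⟩ := h
    exact ⟨s', hs', t', ht', ih h1, h2⟩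

/-- A chain uses only finitely many points, so it already lives in some finite stage of the
exhaustion. -/
theorem AltChain.eventually_of_iUnion {D : ℕ → Set α} (hD : Monotone D) {y : α → ℝ} {a b : ℝ}
    {n : ℕ} {l r : α} (h : AltChain (⋃ k, D k) y a b n l r) :
    ∀ᶠ k in atTop, AltChain (D k) y a b n l r := by
  induction n generalizing r with
  | zero => exact Eventually.of_forall fun _ => h
  | succ n ih =>
    obtain ⟨s, hs, t, ht, h1, h2⟩ := h
    obtain ⟨i, hi⟩ := Set.mem_iUnion.1 hs
    obtain ⟨j, hj⟩ := Set.mem_iUnion.1 ht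
    filter_upwards [ih h1, eventually_ge_atTop i, eventually_ge_atTop j] with k hk hik hjk
    exact ⟨s, hD hik hi, t, hD hjk hj, hk, h2⟩

/-- Each pair of points in the chain forces one more upcrossing. The second clause on `N` drives the
induction: these upcrossings are complete before any index whose time is at least `r`, so the next
pair comes strictly later. -/
theorem AltChain.le_upcrossingsBefore {Ω : Type*} {D : Set α} {Y : α → Ω → ℝ} {ω : Ω} {a b : ℝ}
    (hab : a < b) {g : ℕ → α} (hg : Monotone g) (hD : D ⊆ Set.range g) {n : ℕ} {l r : α}
    (h : AltChain D (fun t => Y t ω) a b n l r) :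
    ∃ N, n ≤ upcrossingsBefore a b (fun k => Y (g k)) N ω ∧ ∀ i, r ≤ g i → N ≤ i := by
  induction n generalizing r with
  | zero => exact ⟨0, by simp, fun i _ => Nat.zero_le i⟩
  | succ n ih =>
    obtain ⟨s, hs, t, ht, h1, h2, h3, h4, h5⟩ := h
    obtain ⟨N, hN, hN'⟩ := ih h1
    obtain ⟨i, rfl⟩ := hD hs
    obtain ⟨j, rfl⟩ := hD ht
    refine ⟨j + 1, ?_, fun k hk => ?_⟩
    · exact Nat.succ_le_of_lt (hN.trans_lt (upcrossingsBefore_lt_of_exists_upcrossing hab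
        (hN' i le_rfl) h4 (hg.reflect_lt h2).le h5))
    · exact hg.reflect_lt (h3.trans_le hk)

theorem AltChain.le_upcrossings {Ω : Type*} {D : Set α} {Y : α → Ω → ℝ} {ω : Ω} {a b : ℝ}
    (hab : a < b) {g : ℕ → α} (hg : Monotone g) (hD : D ⊆ Set.range g) {n : ℕ} {l r : α}
    (h : AltChain D (fun t => Y t ω) a b n l r) :
    (n : ENNReal) ≤ upcrossings a b (fun k => Y (g k)) ω := by
  obtain ⟨N, hN, -⟩ := h.le_upcrossingsBefore hab hg hD
  exact (Nat.cast_le.2 hN).trans (le_iSup (fun N =>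
    ((upcrossingsBefore a b (fun k => Y (g k)) N ω : ℕ) : ENNReal)) N)

/-- Almost every path of a bounded martingale has only finitely many upcrossings of a given
interval along a given countable set of times. -/
theorem MeasureTheory.Martingale.ae_exists_not_altChain {Ω : Type*} {m : MeasurableSpace Ω}
    {Q : Measure Ω} [IsProbabilityMeasure Q] {ℱ : Filtration α m} {Y : α → Ω → ℝ}
    (hY : Martingale Y ℱ Q) {C : ℝ} (hC : ∀ t ω, |Y t ω| ≤ C) (e : ℕ → α) {a b : ℝ}
    (hab : a < b) :
    ∀ᵐ ω ∂Q, ∃ n, ∀ l r, ¬ AltChain (Set.range e) (fun t => Y t ω) a b n l r := by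
  -- Sorting the first `k + 1` times gives a discrete martingale, and Doob's upcrossing inequality
  -- bounds its expected upcrossings independently of `k`. Fatou then makes the liminf over `k`
  -- almost surely finite, whereas chains of all lengths would make it infinite.
  have hF (k : ℕ) := ((Finset.range (k + 1)).image e).exists_monotone_subset_range
    (by simp)
  choose g hg hgF using hF
  have hmart (k : ℕ) : Martingale (fun n => Y (g k n)) 
      ⟨fun n => ℱ (g k n), fun i j hij => ℱ.mono (hg k hij), fun n => ℱ.le _⟩ Q := by
    refine ⟨fun n => hY.1 (g k n), fun i j hij => hY.2 _ _ (hg k hij)⟩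
  have hmeas (k : ℕ) : Measurable (upcrossings a b (fun n => Y (g k n))) :=
    (hmart k).1.measurable_upcrossings hab
  have hbound (k : ℕ) : ∫⁻ ω, upcrossings a b (fun n => Y (g k n)) ω ∂Q ≤
      ENNReal.ofReal (C + |a|) / ENNReal.ofReal (b - a) := by
    rw [ENNReal.le_div_iff_mul_le (by simp [hab]) (by simp), mul_comm]
    refine ((hmart k).submartingale.mul_lintegral_upcrossings_le_lintegral_pos_part a b).trans ?_
    refine iSup_le fun N => ?_
    calc _ ≤ ∫⁻ _, ENNReal.ofReal (C + |a|) ∂Q := by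
          refine lintegral_mono fun ω => ENNReal.ofReal_le_ofReal ?_
          have h1 := abs_le.1 (hC (g k N) ω)
          have h2 := neg_abs_le a
          have h3 := abs_nonneg a
          exact max_le (by linarith) (by linarith)
      _ = _ := by simp
  have hlim : ∫⁻ ω, liminf (fun k => upcrossings a b (fun n => Y (g k n)) ω) atTop ∂Q < ⊤ := by
    refine (lintegral_liminf_le hmeas).trans_lt ?_
    refine (liminf_le_of_frequently_le' (Frequently.of_forall hbound)).trans_lt ?_
    exact ENNReal.div_lt_top (by simp) (by simp [hab])
  filter_upwards [ae_lt_top (.liminf hmeas) hlim.ne] with ω hω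
  by_contra! hcon
  refine hω.ne (ENNReal.eq_top_of_forall_nnreal_le fun x => ?_)
  obtain ⟨n, hn⟩ := exists_nat_ge x
  obtain ⟨l, r, h⟩ := hcon n
  have hU : Set.range e = ⋃ k : ℕ, (((Finset.range (k + 1)).image e : Finset α) : Set α) := by
    ext x
    simp only [Set.mem_range, Set.mem_iUnion, Finset.coe_image, Set.mem_image, Finset.mem_coe,
      Finset.mem_range]
    exact ⟨fun ⟨i, hi⟩ => ⟨i, i, by omega, hi⟩, fun ⟨_, i, _, hi⟩ => ⟨i, hi⟩⟩
  rw [hU] at h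
  have hev := h.eventually_of_iUnion (fun i j hij => by
    simp only [Finset.coe_subset]
    exact Finset.image_subset_image (Finset.range_subset_range.2 (by omega)))
  refine le_liminf_of_le (by isBoundedDefault) (hev.mono fun k hk => ?_)
  refine le_trans ?_ (hk.le_upcrossings hab (hg k) (hgF k))
  exact_mod_cast hn

variable [TopologicalSpace α] [OrderTopology α] [DenselyOrdered α]

theorem exists_tendsto_right_of_not_altChain {D : Set α} {y : α → ℝ} {c C : ℝ}
    (hy : ∀ t, y t ∈ Set.Icc c C)
    (h : ∀ a b : ℚ, a < b → ∃ n, ∀ l r, ¬ AltChain D y a b n l r) {t u : α} (htu : t < u) :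
    ∃ L, Tendsto y (𝓝[D ∩ Set.Ioi t] t) (𝓝 L) := by
  refine tendsto_of_no_upcrossings Rat.denseRange_cast ?_
    (isBoundedUnder_of ⟨C, fun t => (hy t).2⟩) (isBoundedUnder_of ⟨c, fun t => (hy t).1⟩)
  rintro _ ⟨a, rfl⟩ _ ⟨b, rfl⟩ hab ⟨ha, hb⟩
  obtain ⟨n, hn⟩ := h a b (by exact_mod_cast hab)
  -- Oscillation persists arbitrarily close to `t`, so a chain to the right of `l` can always be
  -- lengthened inside `(t, l)`.
  have key (n : ℕ) : ∃ l, t < l ∧ AltChain D y a b n l u := by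
    induction n with
    | zero => exact exists_between htu
    | succ n ih =>
      obtain ⟨l, htl, hl⟩ := ih
      obtain ⟨t₁, hb₁, ⟨ht₁, h₁⟩, h₁'⟩ := (hb.and_eventually (inter_mem self_mem_nhdsWithin
        (mem_nhdsWithin_of_mem_nhds (Iio_mem_nhds htl)))).exists
      obtain ⟨s₁, ha₁, ⟨hs₁, h₂⟩, h₂'⟩ := (ha.and_eventually (inter_mem self_mem_nhdsWithin
        (mem_nhdsWithin_of_mem_nhds (Iio_mem_nhds h₁)))).exists
      obtain ⟨l', h₃, h₃'⟩ := exists_between (show t < s₁ from h₂)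
      exact ⟨l', h₃, hl.prepend hs₁ ht₁ h₃' h₂' h₁' ha₁ hb₁⟩
  obtain ⟨l, -, hl⟩ := key n
  exact hn _ _ hl

theorem exists_tendsto_left_of_not_altChain {D : Set α} {y : α → ℝ} {c C : ℝ}
    (hy : ∀ t, y t ∈ Set.Icc c C)
    (h : ∀ a b : ℚ, a < b → ∃ n, ∀ l r, ¬ AltChain D y a b n l r) {t u : α} (hut : u < t) :
    ∃ L, Tendsto y (𝓝[D ∩ Set.Iio t] t) (𝓝 L) := by
  refine tendsto_of_no_upcrossings Rat.denseRange_cast ?_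
    (isBoundedUnder_of ⟨C, fun t => (hy t).2⟩) (isBoundedUnder_of ⟨c, fun t => (hy t).1⟩)
  rintro _ ⟨a, rfl⟩ _ ⟨b, rfl⟩ hab ⟨ha, hb⟩
  obtain ⟨n, hn⟩ := h a b (by exact_mod_cast hab)
  have key (n : ℕ) : ∃ r, r < t ∧ AltChain D y a b n u r := by
    induction n with
    | zero =>
      obtain ⟨r, h1, h2⟩ := exists_between hut
      exact ⟨r, h2, h1⟩
    | succ n ih =>
      obtain ⟨r, hrt, hr⟩ := ih
      obtain ⟨s₁, ha₁, ⟨hs₁, h₂⟩, h₂'⟩ := (ha.and_eventually (inter_mem self_mem_nhdsWithin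
        (mem_nhdsWithin_of_mem_nhds (Ioi_mem_nhds hrt)))).exists
      obtain ⟨t₁, hb₁, ⟨ht₁, h₁⟩, h₁'⟩ := (hb.and_eventually (inter_mem self_mem_nhdsWithin
        (mem_nhdsWithin_of_mem_nhds (Ioi_mem_nhds h₂)))).exists
      obtain ⟨r', h₃, h₃'⟩ := exists_between (show t₁ < t from h₁)
      exact ⟨r', h₃', s₁, hs₁, t₁, ht₁, hr.mono_right (le_of_lt h₂'), h₁', h₃, ha₁, hb₁⟩
  obtain ⟨r, -, hr⟩ := key n
  exact hn _ _ hr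

end Regularization

/-! ### Càdlàg versions of bounded closed martingales -/

section CadlagVersion

variable {α : Type*} [LinearOrder α] [TopologicalSpace α] [OrderTopology α] [DenselyOrdered α]

theorem Dense.nhdsWithin_inter_Ioi_neBot {D : Set α} (hD : Dense D) {t u : α} (htu : t < u) :
    (𝓝[D ∩ Set.Ioi t] t).NeBot := by
  rw [← mem_closure_iff_nhdsWithin_neBot, Set.inter_comm]
  have h := closure_minimal (hD.open_subset_closure_inter (isOpen_Ioi (a := t))) isClosed_closure
  refine h ?_
  rw [closure_Ioi' ⟨u, htu⟩]
  exact Set.self_mem_Ici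

/-- A function given by right limits along a dense set is right-continuous. -/
theorem continuousWithinAt_Ici_of_tendsto_dense {D : Set α} (hD : Dense D) {y z : α → ℝ}
    {t u : α} (htu : t < u)
    (hz : ∀ v, t ≤ v → v < u → Tendsto y (𝓝[D ∩ Set.Ioi v] v) (𝓝 (z v))) :
    ContinuousWithinAt z (Set.Ici t) t := by
  rw [← continuousWithinAt_Ioi_iff_Ici]
  refine (closed_nhds_basis (z t)).tendsto_right_iff.2 fun K hK => ?_
  have h := hz t le_rfl htu hK.1
  rw [mem_map, mem_nhdsWithin] at h
  obtain ⟨O, hO, htO, hOK⟩ := h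
  obtain ⟨w, htw, hw⟩ := exists_Ico_subset_of_mem_nhds (hO.mem_nhds htO) ⟨u, htu⟩
  filter_upwards [Ioo_mem_nhdsGT (lt_min htw htu)] with v hv
  obtain ⟨hvw, hvu⟩ := lt_min_iff.1 hv.2
  have := hD.nhdsWithin_inter_Ioi_neBot hvu
  refine hK.2.mem_of_tendsto (hz v hv.1.le hvu) ?_
  filter_upwards [inter_mem_nhdsWithin _ (Iio_mem_nhds hvw)] with q hq
  exact hOK ⟨hw ⟨(hv.1.trans hq.1.2).le, hq.2⟩, hq.1.1, hv.1.trans hq.1.2⟩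

/-- A function given by right limits of `y` along a dense set has the left limits of `y`. -/
theorem tendsto_nhdsLT_of_tendsto_dense {D : Set α} (hD : Dense D) {y z : α → ℝ} {t : α} {L : ℝ}
    (hz : ∀ v < t, Tendsto y (𝓝[D ∩ Set.Ioi v] v) (𝓝 (z v)))
    (hL : Tendsto y (𝓝[D ∩ Set.Iio t] t) (𝓝 L)) : Tendsto z (𝓝[<] t) (𝓝 L) := by
  by_cases hmin : ∃ u, u < t
  · refine (closed_nhds_basis L).tendsto_right_iff.2 fun K hK => ?_
    have h := hL hK.1
    rw [mem_map, mem_nhdsWithin] at h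
    obtain ⟨O, hO, htO, hOK⟩ := h
    obtain ⟨w, htw, hw⟩ := exists_Ioc_subset_of_mem_nhds (hO.mem_nhds htO) hmin
    filter_upwards [Ioo_mem_nhdsLT htw] with v hv
    have := hD.nhdsWithin_inter_Ioi_neBot hv.2
    refine hK.2.mem_of_tendsto (hz v hv.2) ?_
    filter_upwards [inter_mem_nhdsWithin _ (Iio_mem_nhds hv.2)] with q hq
    exact hOK ⟨hw ⟨hv.1.trans hq.1.2, le_of_lt hq.2⟩, hq.1.1, hq.2⟩
  · have : Set.Iio t = ∅ := by
      ext x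
      simpa using fun hx => hmin ⟨x, hx⟩
    simp [this]

/-- A limsup ignores finitely many terms, so it is known at every time `j > t`; right-continuity of
the filtration brings this down to `t`. -/
theorem measurable_limsup_of_tendsto_nhdsGT {Ω : Type*} {m : MeasurableSpace Ω}
    (ℱ : Filtration α m) (hℱ : ℱ.IsRightContinuous) {Y : α → Ω → ℝ}
    (hY : ∀ t, Measurable[ℱ t] (Y t)) {t u : α} (htu : t < u) {q : ℕ → α}
    (hq : Tendsto q atTop (𝓝 t)) :
    Measurable[ℱ t] fun ω => limsup (fun n => Y (q n) ω) atTop := by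
  have h : ℱ t = ⨅ j > t, ℱ j := by
    rw [← Filtration.rightCont_eq_of_not_isMax ℱ (not_isMax_iff.2 ⟨u, htu⟩), hℱ.eq]
  intro A hA
  rw [h]
  simp only [MeasurableSpace.measurableSet_iInf]
  intro j hj
  obtain ⟨k, hk⟩ := eventually_atTop.1 (hq.eventually (gt_mem_nhds hj))
  have : (fun ω => limsup (fun n => Y (q n) ω) atTop) =
      fun ω => limsup (fun n => Y (q (n + k)) ω) atTop := by
    funext ω
    exact (limsup_nat_add (fun n => Y (q n) ω) k).symm
  rw [this]
  have hmeas : Measurable[ℱ j] fun ω => limsup (fun n => Y (q (n + k)) ω) atTop :=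
    Measurable.limsup fun n => (hY _).mono (ℱ.mono (hk _ (by omega)).le) le_rfl
  exact hmeas hA

/-- The bounded martingale generated by a bounded random variable has a bounded version. -/
theorem exists_bounded_martingale {ι : Type*} [Preorder ι] {Ω : Type*} {m : MeasurableSpace Ω} {Q : Measure Ω}
    [IsProbabilityMeasure Q] (ℱ : Filtration ι m) {X : Ω → ℝ} (hX : Integrable X Q) {c C : ℝ}
    (hcC : c ≤ C) (hc : ∀ᵐ ω ∂Q, c ≤ X ω) (hC : ∀ᵐ ω ∂Q, X ω ≤ C) :
    ∃ Y : ι → Ω → ℝ, Martingale Y ℱ Q ∧ (∀ t ω, Y t ω ∈ Set.Icc c C) ∧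
      ∀ t, Y t =ᵐ[Q] Q[X | ℱ t] := by
  have heq (t : ι) : (fun ω => max c (min C (Q[X | ℱ t] ω))) =ᵐ[Q] Q[X | ℱ t] := by
    have h1 : (fun _ => c) ≤ᵐ[Q] Q[X | ℱ t] := by
      rw [← condExp_const (μ := Q) (ℱ.le t) c]
      exact condExp_mono (integrable_const _) hX hc
    have h2 : Q[X | ℱ t] ≤ᵐ[Q] fun _ => C := by
      rw [← condExp_const (μ := Q) (ℱ.le t) C]
      exact condExp_mono hX (integrable_const _) hC
    filter_upwards [h1, h2] with ω h1 h2
    rw [min_eq_right h2, max_eq_right h1]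
  refine ⟨fun t ω => max c (min C (Q[X | ℱ t] ω)), ⟨fun t => ?_, fun s t hst => ?_⟩,
    fun t ω => ⟨le_max_left _ _, max_le hcC (min_le_left _ _)⟩, heq⟩
  · exact (show Continuous fun x : ℝ => max c (min C x) by fun_prop).comp_stronglyMeasurable
      stronglyMeasurable_condExp
  · calc _ =ᵐ[Q] Q[Q[X | ℱ t] | ℱ s] := condExp_congr_ae (heq t)
      _ =ᵐ[Q] Q[X | ℱ s] := condExp_condExp_of_le (ℱ.mono hst) (ℱ.le t)
      _ =ᵐ[Q] _ := (heq s).symm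

/-- Doob's regularization: replace a bounded version by its right limits along a dense sequence.
Finiteness of upcrossings supplies these limits, and also the left limits, for almost every path. -/
theorem exists_cadlag_version {T : ℝ} {Ω : Type*} {m : MeasurableSpace Ω} {Q : Measure Ω}
    [IsProbabilityMeasure Q] (ℱ : Filtration (TimeInterval T) m) (hℱ : ℱ.IsRightContinuous)
    {X : Ω → ℝ} (hX : Integrable X Q) {c C : ℝ}
    (hcC : c ≤ C) (hc : ∀ᵐ ω ∂Q, c ≤ X ω) (hC : ∀ᵐ ω ∂Q, X ω ≤ C) :
    ∃ Y : TimeInterval T → Ω → ℝ, (∀ t, StronglyMeasurable[ℱ t] (Y t)) ∧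
      (∀ t ω, Y t ω ∈ Set.Icc c C) ∧ (∀ t, Y t =ᵐ[Q] Q[X | ℱ t]) ∧
      ∀ᵐ ω ∂Q, IsCadlag fun t => Y t ω := by
  obtain ⟨Y, hY, hYb, hYX⟩ := exists_bounded_martingale ℱ hX hcC hc hC
  rcases isEmpty_or_nonempty (TimeInterval T) with hemp | hne
  · exact ⟨Y, fun t => hemp.elim t, hYb, hYX, .of_forall fun ω t => hemp.elim t⟩
  set e : ℕ → TimeInterval T := TopologicalSpace.denseSeq (TimeInterval T) with he
  have hD : Dense (Set.range e) := TopologicalSpace.denseRange_denseSeq _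
  have hgood : ∀ᵐ ω ∂Q, ∀ a b : ℚ, a < b →
      ∃ n, ∀ l r, ¬ AltChain (Set.range e) (fun t => Y t ω) a b n l r := by
    simp_rw [ae_all_iff]
    intro a b hab
    refine hY.ae_exists_not_altChain (C := max |c| |C|) (fun t ω => ?_) e (by exact_mod_cast hab)
    exact abs_le_max_abs_abs (hYb t ω).1 (hYb t ω).2
  have hseq (t : TimeInterval T) (ht : ∃ u, t < u) :
      ∃ q : ℕ → TimeInterval T, Tendsto q atTop (𝓝[Set.range e ∩ Set.Ioi t] t) := by
    obtain ⟨u, hu⟩ := ht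
    have := hD.nhdsWithin_inter_Ioi_neBot hu
    exact exists_seq_tendsto _
  choose q hq using hseq
  classical
  -- A limsup along a fixed sequence decreasing towards `t` is defined and measurable even on
  -- exceptional paths. The last time has nothing to its right, so `Y` is kept there.
  let Z : TimeInterval T → Ω → ℝ := fun t ω =>
    if h : ∃ u, t < u then limsup (fun n => Y (q t h n) ω) atTop else Y t ω
  have hZ_meas (t : TimeInterval T) : Measurable[ℱ t] (Z t) := by
    by_cases h : ∃ u, t < u
    · simp only [Z, h, dite_true]
      obtain ⟨u, hu⟩ := h
      exact measurable_limsup_of_tendsto_nhdsGT ℱ hℱ (fun t => (hY.1 t).measurable) hu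
        ((hq t _).mono_right nhdsWithin_le_nhds)
    · simp only [Z, h, dite_false]
      exact (hY.1 t).measurable
  have hZ_lim : ∀ᵐ ω ∂Q, ∀ t : TimeInterval T, (∃ u, t < u) →
      Tendsto (fun s => Y s ω) (𝓝[Set.range e ∩ Set.Ioi t] t) (𝓝 (Z t ω)) := by
    filter_upwards [hgood] with ω hω t ht
    obtain ⟨u, hu⟩ := ht
    obtain ⟨L, hL⟩ := exists_tendsto_right_of_not_altChain (fun t => hYb t ω) hω hu
    have : Z t ω = L := by
      simp only [Z, show ∃ u, t < u from ⟨u, hu⟩, dite_true]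
      exact (hL.comp (hq t _)).limsup_eq
    rwa [this]
  have hZ_mem (t : TimeInterval T) (ω : Ω) : Z t ω ∈ Set.Icc c C := by
    by_cases h : ∃ u, t < u
    · simp only [Z, h, dite_true]
      have hb (n : ℕ) := hYb (q t h n) ω
      constructor
      · exact le_limsup_of_frequently_le (Frequently.of_forall fun n => (hb n).1)
          (isBoundedUnder_of ⟨C, fun n => (hb n).2⟩)
      · exact limsup_le_of_le (isCoboundedUnder_le_of_le _ fun n => (hb n).1)
          (Eventually.of_forall fun n => (hb n).2)
    · simp only [Z, h, dite_false]
      exact hYb t ω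
  refine ⟨Z, fun t => (hZ_meas t).stronglyMeasurable, hZ_mem, fun t => ?_, ?_⟩
  · by_cases h : ∃ u, t < u
    · have hint : Integrable (Z t) Q :=
        .of_mem_Icc c C ((hZ_meas t).mono (ℱ.le t) le_rfl).aemeasurable
          (.of_forall fun ω => hZ_mem t ω)
      refine ae_eq_condExp_of_forall_setIntegral_eq (ℱ.le t) hX
        (fun _ _ _ => hint.integrableOn) (fun A hA _ => ?_)
        (hZ_meas t).stronglyMeasurable.aestronglyMeasurable
      have hqt := hq t h
      have hev : ∀ᶠ n in atTop, q t h n ∈ Set.range e ∩ Set.Ioi t := hqt self_mem_nhdsWithin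
      -- For `A` known at time `t`, these integrals eventually all equal the integral of `X` over
      -- `A`; dominated convergence passes this to `Z t`.
      have hlim : Tendsto (fun n => ∫ ω in A, Y (q t h n) ω ∂Q) atTop (𝓝 (∫ ω in A, Z t ω ∂Q)) := by
        refine tendsto_integral_of_dominated_convergence (fun _ => max |c| |C|)
          (fun n => ((hY.1 _).mono (ℱ.le _)).aestronglyMeasurable) (integrable_const _)
          (fun n => .of_forall fun ω => abs_le_max_abs_abs (hYb _ ω).1 (hYb _ ω).2) ?_
        filter_upwards [ae_restrict_of_ae hZ_lim] with ω hω
        exact (hω t h).comp hqt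
      refine tendsto_nhds_unique hlim (tendsto_const_nhds.congr' ?_)
      filter_upwards [hev] with n hn
      have hA' : MeasurableSet[ℱ (q t h n)] A := ℱ.mono (le_of_lt hn.2) A hA
      rw [setIntegral_congr_ae (g := Q[X | ℱ (q t h n)]) (ℱ.le _ A hA')
        ((hYX _).mono fun ω h _ => h), setIntegral_condExp (ℱ.le _) hX hA']
    · simp only [Z, h, dite_false]
      exact hYX t
  · filter_upwards [hgood, hZ_lim] with ω hω hlim t
    constructor
    · by_cases h : ∃ u, t < u
      · obtain ⟨u, hu⟩ := h
        exact continuousWithinAt_Ici_of_tendsto_dense hD hu fun v _ hv => hlim v ⟨u, hv⟩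
      · have : Set.Ici t = {t} := by
          ext x
          simp only [Set.mem_Ici, Set.mem_singleton_iff]
          push Not at h
          exact ⟨fun hx => le_antisymm (h x) hx, fun hx => hx.ge⟩
        rw [this]
        exact continuousWithinAt_singleton
    · by_cases h : ∃ u, u < t
      · obtain ⟨u, hu⟩ := h
        obtain ⟨L, hL⟩ := exists_tendsto_left_of_not_altChain (fun t => hYb t ω) hω hu
        exact ⟨L, tendsto_nhdsLT_of_tendsto_dense hD (fun v hv => hlim v ⟨t, hv⟩) hL⟩
      · have : Set.Iio t = ∅ := by
          ext x
          simpa using fun hx => h ⟨x, hx⟩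
        exact ⟨0, by simp [this]⟩

end CadlagVersion

/-! ### Tube events and their conditional probabilities -/

section PathEvents

/-- For a continuous process, staying in an open set during a compact set of times is an event. -/
theorem measurableSet_forall_mem_of_isCompact {Ω ι E : Type*} {m : MeasurableSpace Ω}
    [TopologicalSpace ι] [SecondCountableTopology ι] [PseudoMetricSpace E] [MeasurableSpace E]
    [OpensMeasurableSpace E] {S : ι → Ω → E} (hS : ∀ ω, Continuous fun u => S u ω) {K : Set ι}
    (hK : IsCompact K) (hm : ∀ u ∈ K, Measurable (S u)) {U : Set E} (hU : IsOpen U) :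
    MeasurableSet {ω | ∀ u ∈ K, S u ω ∈ U} := by
  obtain ⟨D, hDc, hD⟩ := TopologicalSpace.exists_countable_dense K
  -- A compact piece of path inside `U` keeps a positive distance from the complement. Membership in
  -- the closed set `F n` need only be tested on a countable dense set of times.
  let F : ℕ → Set E := fun n => {x | ENNReal.ofReal (1 / (n + 1)) ≤ Metric.infEDist x Uᶜ}
  have hF (n : ℕ) : IsClosed (F n) := isClosed_le continuous_const Metric.continuous_infEDist
  have hFU (n : ℕ) : F n ⊆ U := by
    intro x hx
    by_contra hxU
    have h0 : Metric.infEDist x Uᶜ = 0 := Metric.infEDist_zero_of_mem hxU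
    have : ENNReal.ofReal (1 / (n + 1)) ≤ 0 := h0 ▸ hx
    rw [nonpos_iff_eq_zero, ENNReal.ofReal_eq_zero] at this
    exact absurd this (not_le.2 (by positivity))
  have key : {ω | ∀ u ∈ K, S u ω ∈ U} = ⋃ n, ⋂ u ∈ D, {ω | S u ω ∈ F n} := by
    ext ω
    simp only [Set.mem_ofPred_eq, Set.mem_iUnion, Set.mem_iInter]
    constructor
    · intro h
      obtain ⟨δ, hδ, hδU⟩ := (hK.image (hS ω)).exists_thickening_subset_open hU
        (Set.image_subset_iff.2 h)
      obtain ⟨n, hn⟩ := exists_nat_one_div_lt hδ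
      refine ⟨n, fun u _ => Metric.le_infEDist.2 fun y hy => ?_⟩
      by_contra! hlt
      refine hy (hδU (Metric.mem_thickening_iff.2 ⟨S u ω, ⟨u, u.2, rfl⟩, ?_⟩))
      rw [edist_comm, edist_dist] at hlt
      exact ((ENNReal.ofReal_lt_ofReal_iff_of_nonneg dist_nonneg).1 hlt).trans hn
    · rintro ⟨n, hn⟩ u hu
      have hcl : IsClosed {v : K | S v ω ∈ F n} :=
        (hF n).preimage ((hS ω).comp continuous_subtype_val)
      have : (⟨u, hu⟩ : K) ∈ {v : K | S v ω ∈ F n} := by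
        have h := closure_minimal (s := D) (fun v hv => hn v hv) hcl
        exact h (hD _)
      exact hFU n this
  rw [key]
  exact .iUnion fun n => .biInter hDc fun u _ => hm u u.2 (hF n).measurableSet

variable {Ω : Type*} {d : ℕ} {T : ℝ}

/-- The Borel σ-algebra of the path space is generated by the compact-open subbasis, whose preimages
are events of staying in an open set during a compact set of times. -/
theorem measurable_restrictPath {m : MeasurableSpace Ω} {S : TimeInterval T → Ω → Orthant d}
    (hS : ∀ ω, Continuous fun u => S u ω) (hm : ∀ u, Measurable (S u)) (t : TimeInterval T) :
    Measurable (restrictPath S hS t) := by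
  have h : PathSpace.instMeasurableSpace d t = _ :=
    borel_eq_generateFrom_of_subbasis ContinuousMap.compactOpen_eq
  rw [h]
  refine measurable_generateFrom ?_
  rintro _ ⟨K, hK, U, hU, rfl⟩
  have := measurableSet_forall_mem_of_isCompact (S := fun (u : Set.Ici t) ω => S u ω)
    (fun ω => (hS ω).comp continuous_subtype_val) hK (fun u _ => hm u) hU
  exact this

/-- The event that `S` stays in `U` during `[a, b]` and is in `V` at time `b`. -/
def tubeEvent (S : TimeInterval T → Ω → Orthant d) (a b : TimeInterval T)
    (U V : Set (Fin d → ℝ)) : Set Ω :=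
  {ω | (∀ u ∈ Set.Icc a b, (S u ω : Fin d → ℝ) ∈ U) ∧ (S b ω : Fin d → ℝ) ∈ V}

theorem measurableSet_tubeEvent {mΩ : MeasurableSpace Ω} {ℱ : Filtration (TimeInterval T) mΩ}
    {S : TimeInterval T → Ω → Orthant d} (hS : ∀ ω, Continuous fun u => S u ω)
    (hSa : Adapted ℱ S) (a b : TimeInterval T) {U V : Set (Fin d → ℝ)} (hU : IsOpen U)
    (hV : IsOpen V) : MeasurableSet[ℱ b] (tubeEvent S a b U V) := by
  refine MeasurableSet.inter ?_ ?_
  · exact measurableSet_forall_mem_of_isCompact (m := ℱ b) hS isClosed_Icc.isCompact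
      (fun u hu => (hSa u).mono (ℱ.mono hu.2) le_rfl) (hU.preimage continuous_subtype_val)
  · exact hSa b (hV.preimage continuous_subtype_val).measurableSet

/-- A straight path inside a convex set. -/
theorem exists_path_of_convex {a b : TimeInterval T} (hab : a < b) {U V : Set (Fin d → ℝ)}
    (hU : Convex ℝ U) (y v : Orthant d) (hy : (y : Fin d → ℝ) ∈ U) (hvU : (v : Fin d → ℝ) ∈ U)
    (hvV : (v : Fin d → ℝ) ∈ V) :
    ∃ f : PathSpace d a, f ⟨a, Set.self_mem_Ici⟩ = y ∧
      (∀ u : Set.Ici a, u.1 ≤ b → (f u : Fin d → ℝ) ∈ U) ∧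
      (f ⟨b, hab.le⟩ : Fin d → ℝ) ∈ V := by
  have hab' : (0 : ℝ) < b - a := sub_pos.2 hab
  let θ : Set.Ici a → ℝ := fun u => min 1 (((u.1 : ℝ) - a) / (b - a))
  have hθ0 (u : Set.Ici a) : 0 ≤ θ u :=
    le_min zero_le_one (div_nonneg (sub_nonneg.2 (show (a : ℝ) ≤ u.1 from u.2)) hab'.le)
  have hθ1 (u : Set.Ici a) : θ u ≤ 1 := min_le_left _ _
  have hpos : Convex ℝ {x : Fin d → ℝ | ∀ i, 0 < x i} := by
    intro x hx z hz s t hs ht hst i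
    simp only [Pi.add_apply, Pi.smul_apply, smul_eq_mul]
    rcases hs.eq_or_lt with rfl | hs
    · have : t = 1 := by linarith
      simpa [this] using hz i
    · have h1 := mul_pos hs (hx i)
      have h2 := mul_nonneg ht (hz i).le
      linarith
  let c : Set.Ici a → Fin d → ℝ := fun u => (1 - θ u) • (y : Fin d → ℝ) + θ u • (v : Fin d → ℝ)
  have hc {W : Set (Fin d → ℝ)} (hW : Convex ℝ W) (h1 : (y : Fin d → ℝ) ∈ W)
      (h2 : (v : Fin d → ℝ) ∈ W) (u) : c u ∈ W :=
    hW h1 h2 (sub_nonneg.2 (hθ1 u)) (hθ0 u) (by ring)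
  have hcont : Continuous c := by
    have : Continuous θ := by fun_prop
    fun_prop
  refine ⟨⟨fun u => ⟨c u, hc hpos y.2 v.2 u⟩, hcont.subtype_mk _⟩, ?_, fun u _ => hc hU hy hvU u, ?_⟩
  · ext1
    simp [c, θ]
  · have : θ ⟨b, hab.le⟩ = 1 := by simp [θ, div_self hab'.ne']
    simpa [c, this] using hvV

/-- Under conditional full support, tubes around straight paths have positive conditional
probability. -/
theorem ConditionalFullSupport.exists_condProb_tubeEvent {mΩ : MeasurableSpace Ω} {P : Measure Ω}
    [IsFiniteMeasure P] {ℱ : Filtration (TimeInterval T) mΩ}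
    {S : TimeInterval T → Ω → Orthant d} {hS : ∀ ω, Continuous fun u => S u ω}
    (hCFS : ConditionalFullSupport P ℱ S hS) (hSa : Adapted ℱ S) {a b : TimeInterval T}
    (hab : a < b) {U V : Set (Fin d → ℝ)} (hU : IsOpen U) (hUc : Convex ℝ U) (hV : IsOpen V) :
    ∃ g : Ω → ENNReal, Measurable[ℱ a] g ∧ (∀ ω, g ω ≠ ⊤) ∧
      (∀ B, MeasurableSet[ℱ a] B → ∫⁻ ω in B, g ω ∂P = P (B ∩ tubeEvent S a b U V)) ∧
      ((∃ v : Orthant d, (v : Fin d → ℝ) ∈ U ∩ V) →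
        ∀ᵐ ω ∂P, (S a ω : Fin d → ℝ) ∈ U → g ω ≠ 0) := by
  -- The tube event is the preimage of this open set of paths, so its conditional probability is
  -- positive as soon as `G` meets the support of the conditional law; the straight path is the
  -- point where they meet.
  let G : Set (PathSpace d a) :=
    {f | Set.MapsTo f {u : Set.Ici a | u.1 ≤ b} (Subtype.val ⁻¹' U)} ∩
      {f | f ⟨b, hab.le⟩ ∈ (Subtype.val ⁻¹' V : Set (Orthant d))}
  have hG : IsOpen G := by
    refine IsOpen.inter ?_ ?_
    · exact ContinuousMap.isOpen_setOfPred_mapsTo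
        (isClosed_le continuous_subtype_val continuous_const).isCompact
        (hU.preimage continuous_subtype_val)
    · exact (hV.preimage continuous_subtype_val).preimage (continuous_eval_const _)
  have hGS : restrictPath S hS a ⁻¹' G = tubeEvent S a b U V := by
    ext ω
    simp only [G, tubeEvent, restrictPath, Set.mem_preimage, Set.mem_inter_iff, Set.mem_ofPred_eq,
      Set.MapsTo, Set.mem_Icc, ContinuousMap.coe_mk, Subtype.forall, Set.mem_Ici, and_imp]
  have hmeas : Measurable (restrictPath S hS a) :=
    measurable_restrictPath hS (fun u => (hSa u).mono (ℱ.le u) le_rfl) a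
  refine ⟨fun ω => condLaw P (ℱ a) (restrictPath S hS a) ω G, ?_, ?_, ?_, ?_⟩
  · exact Kernel.measurable_coe _ hG.measurableSet
  · intro ω
    have : @IsMarkovKernel Ω _ (ℱ a) _ (condLaw P (ℱ a) (restrictPath S hS a)) := by
      unfold condLaw
      infer_instance
    exact measure_ne_top _ _
  · intro B hB
    have := @setLIntegral_preimage_condDistrib Ω Ω (PathSpace d a) _ _ _ mΩ P _ id
      (restrictPath S hS a) (ℱ a) G B (measurable_id.mono (ℱ.le a) le_rfl) hmeas.aemeasurable
      hG.measurableSet hB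
    rw [← hGS]
    exact this
  · rintro ⟨v, hvU, hvV⟩
    have haT : (a : ℝ) < T := lt_of_lt_of_le (show (a : ℝ) < b from hab) b.2.2
    filter_upwards [hCFS a haT] with ω hω hSω
    obtain ⟨f, hf, hfU, hfV⟩ := exists_path_of_convex hab hUc (S a ω) v hSω hvU hvV
    have hmem : f ∈ (condLaw P (ℱ a) (restrictPath S hS a) ω).support := by
      rw [hω]
      exact hf
    exact (Measure.mem_support_iff_forall f |>.1 hmem G
      (hG.mem_nhds ⟨fun u hu => hfU u hu, hfV⟩)).ne'

end PathEvents

/-! ### Prescribing conditional probabilities by a change of measure -/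

section ChangeOfMeasure

/-- The hypothesis says that `g` is the conditional probability of `A` given `m`: the measure with
density `g` and the restriction to `A` agree on `m`, hence integrate `m`-measurable functions alike.
-/
theorem lintegral_mul_eq_setLIntegral_of_forall_setLIntegral {Ω : Type*} {m mΩ : MeasurableSpace Ω}
    (hm : m ≤ mΩ) {P : Measure Ω} {A : Set Ω} {g φ : Ω → ENNReal}
    (hgm : Measurable[m] g) (hg : ∀ B, MeasurableSet[m] B → ∫⁻ ω in B, g ω ∂P = P (B ∩ A))
    (hφ : Measurable[m] φ) : ∫⁻ ω, g ω * φ ω ∂P = ∫⁻ ω in A, φ ω ∂P := by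
  have h : (P.withDensity g).trim hm = (P.restrict A).trim hm := by
    refine @Measure.ext _ m _ _ fun B hB => ?_
    rw [trim_measurableSet_eq hm hB, trim_measurableSet_eq hm hB, withDensity_apply _ (hm B hB),
      hg B hB, Measure.restrict_apply (hm B hB)]
  rw [← lintegral_trim hm (μ := P.restrict A) hφ, ← h, lintegral_trim hm hφ,
    lintegral_withDensity_eq_lintegral_mul _ (hgm.mono hm le_rfl) (hφ.mono hm le_rfl)]
  rfl

/-- Given finitely many pairwise disjoint events `A c ∩ H c`, with `H c` known at the initial
time, and positive conditional probabilities `g c` of `A c`, one can change the measure after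
the initial time in such a way that the new conditional probability of `A c` is `p c` on `H c`. -/
theorem exists_change_of_measure {Ω κ : Type*} [Fintype κ] {m m' mΩ : MeasurableSpace Ω}
    (hm : m ≤ m') (hm' : m' ≤ mΩ) {P : Measure Ω} {Z : Ω → ENNReal} (hZ : Measurable[m] Z)
    {A H : κ → Set Ω} (hA : ∀ c, MeasurableSet[m'] (A c)) (hH : ∀ c, MeasurableSet[m] (H c))
    (hdisj : ∀ c c', c ≠ c' → Disjoint (A c ∩ H c) (A c' ∩ H c')) {p : κ → ENNReal} {g : κ → Ω → ENNReal} (hgm : ∀ c, Measurable[m] (g c))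
    (hg : ∀ c B, MeasurableSet[m] B → ∫⁻ ω in B, g c ω ∂P = P (B ∩ A c))
    (hgtop : ∀ c ω, g c ω ≠ ⊤)
    (hpos : ∀ c, p c ≠ 0 → ∀ᵐ ω ∂P, ω ∈ H c → Z ω ≠ 0 → g c ω ≠ 0)
    (hsum : ∀ᵐ ω ∂P.withDensity Z, ∑ c, (H c).indicator (fun _ => p c) ω = 1) :
    ∃ Z' : Ω → ENNReal, Measurable[m'] Z' ∧ P.withDensity Z' ≪ P.withDensity Z ∧
      (∀ B, MeasurableSet[m] B → P.withDensity Z' B = P.withDensity Z B) ∧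
      (∀ c B, MeasurableSet[m] B →
        P.withDensity Z' (B ∩ (A c ∩ H c)) = p c * P.withDensity Z (B ∩ H c)) ∧
      ∀ᵐ ω ∂P.withDensity Z', ∃ c, p c ≠ 0 ∧ ω ∈ A c ∩ H c := by
  have hmm := hm.trans hm'
  have hE (c : κ) : MeasurableSet[m'] (A c ∩ H c) := (hA c).inter (hm _ (hH c))
  let φ : κ → Ω → ENNReal := fun c ω => Z ω * (p c * (g c ω)⁻¹)
  have hφ (c : κ) : Measurable[m] (φ c) := by
    have h1 : Measurable[m] fun ω => (g c ω)⁻¹ := (hgm c).inv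
    exact hZ.mul (h1.const_mul (p c))
  -- On each event the old conditional probability `g c` is divided out and replaced by `p c`.
  -- Outside all of them the new density vanishes.
  let D : Ω → ENNReal := fun ω => ∑ c, (A c ∩ H c).indicator (fun ω => p c * (g c ω)⁻¹) ω
  have hD : Measurable[m'] D := by
    refine Finset.measurable_fun_sum _ fun c _ => Measurable.indicator ?_ (hE c)
    exact ((hgm c).mono hm le_rfl).inv.const_mul (p c)
  have hZD (ω : Ω) : Z ω * D ω = ∑ c, (A c ∩ H c).indicator (φ c) ω := by
    simp only [D, Finset.mul_sum, φ]
    refine Finset.sum_congr rfl fun c _ => ?_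
    by_cases h : ω ∈ A c ∩ H c
    · simp only [Set.indicator_of_mem h]
    · simp only [Set.indicator_of_notMem h, mul_zero]
  have hQ' (B : Set Ω) (hB : MeasurableSet B) : P.withDensity (fun ω => Z ω * D ω) B =
      ∑ c, ∫⁻ ω in B ∩ (A c ∩ H c), φ c ω ∂P := by
    rw [withDensity_apply _ hB]
    simp_rw [hZD]
    rw [lintegral_finsetSum]
    · refine Finset.sum_congr rfl fun c _ => ?_
      rw [lintegral_indicator (hm' _ (hE c)), Measure.restrict_restrict (hm' _ (hE c)),
        Set.inter_comm]
    · exact fun c _ => ((hφ c).mono hmm le_rfl).indicator (hm' _ (hE c))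
  have hone (c : κ) (B : Set Ω) (hB : MeasurableSet[m] B) :
      ∫⁻ ω in B ∩ (A c ∩ H c), φ c ω ∂P = p c * P.withDensity Z (B ∩ H c) := by
    have hBH : MeasurableSet[m] (B ∩ H c) := hB.inter (hH c)
    have h1 : ∫⁻ ω in B ∩ (A c ∩ H c), φ c ω ∂P =
        ∫⁻ ω in A c, (B ∩ H c).indicator (φ c) ω ∂P := by
      rw [lintegral_indicator (hmm _ hBH), Measure.restrict_restrict (hmm _ hBH)]
      congr 2
      ext ω
      simp only [Set.mem_inter_iff]
      tauto
    have hind : Measurable[m] ((B ∩ H c).indicator (φ c)) := (hφ c).indicator hBH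
    rw [h1, ← lintegral_mul_eq_setLIntegral_of_forall_setLIntegral hmm (hgm c) (hg c) hind,
      withDensity_apply _ (hmm _ hBH), ← lintegral_indicator (hmm _ hBH),
      ← lintegral_const_mul _ ((hZ.mono hmm le_rfl).indicator (hmm _ hBH))]
    rcases eq_or_ne (p c) 0 with hp0 | hp0
    · have : φ c = 0 := by
        funext ω
        simp [φ, hp0]
      simp [this, hp0]
    · refine lintegral_congr_ae ?_
      filter_upwards [hpos c hp0] with ω hω
      by_cases hmem : ω ∈ B ∩ H c
      · simp only [Set.indicator_of_mem hmem, φ]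
        rcases eq_or_ne (Z ω) 0 with hZ0 | hZ0
        · simp [hZ0]
        · calc g c ω * (Z ω * (p c * (g c ω)⁻¹)) = p c * Z ω * (g c ω * (g c ω)⁻¹) := by ring
            _ = p c * Z ω := by rw [ENNReal.mul_inv_cancel (hω hmem.2 hZ0) (hgtop c ω), mul_one]
      · simp only [Set.indicator_of_notMem hmem, mul_zero]
  refine ⟨fun ω => Z ω * D ω, (hZ.mono hm le_rfl).mul hD, ?_, fun B hB => ?_, fun c B hB => ?_, ?_⟩
  · have : P.withDensity (fun ω => Z ω * D ω) = (P.withDensity Z).withDensity D :=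
      withDensity_mul P (hZ.mono hmm le_rfl) (hD.mono hm' le_rfl)
    rw [this]
    exact withDensity_absolutelyContinuous _ _
  · rw [hQ' B (hmm B hB)]
    simp_rw [fun c => hone c B hB]
    calc ∑ c, p c * P.withDensity Z (B ∩ H c)
        = ∑ c, ∫⁻ ω in B, (H c).indicator (fun _ => p c) ω ∂P.withDensity Z := by
          refine Finset.sum_congr rfl fun c _ => ?_
          rw [lintegral_indicator_const (hmm _ (hH c)), Measure.restrict_apply (hmm _ (hH c)),
            Set.inter_comm]
      _ = ∫⁻ ω in B, ∑ c, (H c).indicator (fun _ => p c) ω ∂P.withDensity Z :=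
          (lintegral_finsetSum _ fun c _ => measurable_const.indicator (hmm _ (hH c))).symm
      _ = ∫⁻ ω in B, 1 ∂P.withDensity Z := lintegral_congr_ae (ae_restrict_of_ae hsum)
      _ = P.withDensity Z B := by simp
  · rw [hQ' _ ((hmm B hB).inter (hm' _ (hE c))), Finset.sum_eq_single c]
    · rw [Set.inter_assoc, Set.inter_self, hone c B hB]
    · intro c' _ hc'
      rw [Set.inter_assoc, (hdisj c c' hc'.symm).inter_eq]
      simp
    · simp
  · have h0 : ∀ᵐ ω ∂P.withDensity (fun ω => Z ω * D ω), D ω ≠ 0 := by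
      exact (ae_withDensity_iff (f := fun ω => Z ω * D ω)
        ((hZ.mono hmm le_rfl).mul (hD.mono hm' le_rfl))).2
        (.of_forall fun ω h => right_ne_zero_of_mul h)
    filter_upwards [h0] with ω hω
    obtain ⟨c, -, hc⟩ := Finset.exists_ne_zero_of_sum_ne_zero hω
    have hmem := Set.mem_of_indicator_ne_zero hc
    rw [Set.indicator_of_mem hmem] at hc
    exact ⟨c, left_ne_zero_of_mul hc, hmem⟩

end ChangeOfMeasure

/-! ### Inductive embedding of the discrete process -/

section Embedding

/-- The event that the process `J` follows the path `h` up to time `k`. -/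
def historyEvent {Ω I : Type*} (J : ℕ → Ω → I) (k : ℕ) (h : ℕ → I) : Set Ω :=
  {ω | ∀ j ≤ k, J j ω = h j}

theorem historyEvent_congr {Ω I : Type*} (J : ℕ → Ω → I) {k : ℕ} {h h' : ℕ → I}
    (hh : ∀ j ≤ k, h j = h' j) : historyEvent J k h = historyEvent J k h' := by
  ext ω
  exact forall₂_congr fun j hj => by rw [hh j hj]

theorem historyEvent_succ_subset {Ω I : Type*} (J : ℕ → Ω → I) (k : ℕ) (h : ℕ → I) :
    historyEvent J (k + 1) h ⊆ historyEvent J k h :=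
  fun _ hω j hj => hω j (hj.trans k.le_succ)

theorem measurableSet_historyEvent {Ω I : Type*} {mΩ : MeasurableSpace Ω} [MeasurableSpace I]
    [MeasurableSingletonClass I] {J : ℕ → Ω → I} {k : ℕ} (hJ : ∀ j ≤ k, Measurable (J j))
    (h : ℕ → I) : MeasurableSet (historyEvent J k h) := by
  have : historyEvent J k h = ⋂ j ∈ Set.Iic k, {ω | J j ω = h j} := by
    ext ω
    simp [historyEvent]
  rw [this]
  exact .biInter (Set.to_countable _) fun j hj => hJ j hj (measurableSet_singleton _)

/-- The extension of a finite path by periodicity. -/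
def extendPath {I : Type*} {n : ℕ} (c : Fin (n + 1) → I) (j : ℕ) : I := c (Fin.ofNat (n + 1) j)

theorem extendPath_restrict {I : Type*} {n : ℕ} (h : ℕ → I) {j : ℕ} (hj : j ≤ n) :
    extendPath (fun i : Fin (n + 1) => h i) j = h j := by
  simp [extendPath, Nat.mod_eq_of_lt (Nat.lt_succ_of_le hj)]

theorem eq_of_extendPath_eq {I : Type*} {n : ℕ} {c c' : Fin (n + 1) → I}
    (h : ∀ j ≤ n, extendPath c j = extendPath c' j) : c = c' := by
  funext j
  simpa [extendPath] using h j (Nat.lt_succ_iff.1 j.2)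

theorem sum_measure_inter_historyEvent {Ω I : Type*} [Fintype I] [MeasurableSpace I]
    [MeasurableSingletonClass I] {mΩ : MeasurableSpace Ω} (μ : Measure Ω) {m : ℕ → Ω → I}
    (hm : ∀ j, Measurable (m j)) (n : ℕ) {E : Set Ω} (hE : MeasurableSet E) :
    ∑ c : Fin (n + 1) → I, μ (E ∩ historyEvent m n (extendPath c)) = μ E := by
  classical
  rw [← tsum_fintype (L := .unconditional _), ← measure_iUnion]
  · congr 1
    ext ω
    simp only [Set.mem_iUnion, Set.mem_inter_iff]
    refine ⟨fun ⟨_, h, _⟩ => h, fun h => ⟨fun j => m j ω, h, fun j hj => ?_⟩⟩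
    exact (extendPath_restrict (fun j => m j ω) hj).symm
  · intro c c' hcc
    refine Set.disjoint_left.2 fun ω h h' => hcc (eq_of_extendPath_eq fun j hj => ?_)
    rw [← h.2 j hj, ← h'.2 j hj]
  · exact fun c => hE.inter (measurableSet_historyEvent (fun j _ => hm j) _)

/-- There are finitely many histories, and those of `μ`-measure zero are `Q`-null by equality of the
laws. Hence properties of the possible transitions of `m` hold almost surely along `J`. -/
theorem ae_measure_historyEvent_ne_zero {Ω Ω' I : Type*} [Finite I] {mΩ : MeasurableSpace Ω}
    {mΩ' : MeasurableSpace Ω'} {Q : Measure Ω} {μ : Measure Ω'} {J : ℕ → Ω → I} {m : ℕ → Ω' → I}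
    {k : ℕ} (hlaw : ∀ h, Q (historyEvent J k h) = μ (historyEvent m k h)) :
    ∀ᵐ ω ∂Q, μ (historyEvent m k fun j => J j ω) ≠ 0 := by
  have hne : ∀ᵐ ω ∂Q, ∀ c : Fin (k + 1) → I,
      ω ∈ historyEvent J k (extendPath c) → μ (historyEvent m k (extendPath c)) ≠ 0 := by
    rw [ae_all_iff]
    intro c
    by_cases h0 : μ (historyEvent m k (extendPath c)) = 0
    · have : Q (historyEvent J k (extendPath c)) = 0 := by rw [hlaw, h0]
      filter_upwards [measure_eq_zero_iff_ae_notMem.1 this] with ω h1 h2 using absurd h2 h1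
    · exact .of_forall fun ω _ => h0
  filter_upwards [hne] with ω hω
  have hself (j : ℕ) (hj : j ≤ k) := extendPath_restrict (fun j => J j ω) hj
  have hw := hω (fun j => J j ω) fun j hj => (hself j hj).symm
  rwa [historyEvent_congr m hself] at hw

variable {Ω Ω' I : Type*} {mΩ : MeasurableSpace Ω} {mΩ' : MeasurableSpace Ω'} {d : ℕ} {T : ℝ}

/-- Under the probability measure with density `Z`, the process `J` has up to time `k` the law of
the process `m` under `μ`, also conditionally with respect to the filtration `ℱ`, and `S` stays
in the tubes `U` and is at the last grid time in the target `V` associated with `J`. -/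
structure IsEmbedding (P : Measure Ω) (ℱ : Filtration (TimeInterval T) mΩ)
    (S : TimeInterval T → Ω → Orthant d) (τ : ℕ → TimeInterval T) (U V : I → Set (Fin d → ℝ))
    (J : ℕ → Ω → I) (μ : Measure Ω') (m : ℕ → Ω' → I) (Q₀ : Measure Ω) (k : ℕ)
    (Z : Ω → ENNReal) : Prop where
  measurable : Measurable[ℱ (τ k)] Z
  absolutelyContinuous : P.withDensity Z ≪ Q₀
  law : ∀ h, P.withDensity Z (historyEvent J k h) = μ (historyEvent m k h)
  mem_target : ∀ᵐ ω ∂P.withDensity Z, (S (τ k) ω : Fin d → ℝ) ∈ V (J k ω)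
  mem_tube : ∀ᵐ ω ∂P.withDensity Z, ∀ j < k, ∀ u ∈ Set.Icc (τ j) (τ (j + 1)),
    (S u ω : Fin d → ℝ) ∈ U (J j ω)
  cond : ∀ j < k, ∀ h B, MeasurableSet[ℱ (τ j)] B →
    P.withDensity Z (B ∩ historyEvent J (j + 1) h) * μ (historyEvent m j h) =
      P.withDensity Z (B ∩ historyEvent J j h) * μ (historyEvent m (j + 1) h)

/-- One steering step: the change of measure is applied to all paths `c` of length `k + 2`, with the
tube from state `c k` to the target of `c (k + 1)` as event and the transition probability of `m` as
new conditional probability. Disjointness of the events comes from reading the path back through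
`J`. -/
theorem IsEmbedding.succ [Fintype I] [MeasurableSpace I] [MeasurableSingletonClass I]
    {P : Measure Ω} [IsFiniteMeasure P] {ℱ : Filtration (TimeInterval T) mΩ}
    {S : TimeInterval T → Ω → Orthant d} {hS : ∀ ω, Continuous fun u => S u ω}
    (hCFS : ConditionalFullSupport P ℱ S hS) (hSa : Adapted ℱ S)
    {τ : ℕ → TimeInterval T} (hτm : Monotone τ) {U V : I → Set (Fin d → ℝ)}
    (hU : ∀ i, IsOpen (U i)) (hUc : ∀ i, Convex ℝ (U i)) (hV : ∀ i, IsOpen (V i))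
    (hVU : ∀ i, V i ⊆ U i) {J : ℕ → Ω → I} (hJ : ∀ k, Measurable[ℱ (τ k)] (J k))
    (hJV : ∀ k ω i, (S (τ k) ω : Fin d → ℝ) ∈ V i → J k ω = i)
    {μ : Measure Ω'} [IsProbabilityMeasure μ] {m : ℕ → Ω' → I} (hm : ∀ j, Measurable (m j))
    {Q₀ : Measure Ω} {k : ℕ} (hτ : τ k < τ (k + 1))
    (htrans : ∀ h, μ (historyEvent m (k + 1) h) ≠ 0 →
      ∃ v : Orthant d, (v : Fin d → ℝ) ∈ U (h k) ∩ V (h (k + 1)))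
    {Z : Ω → ENNReal} (hZ : IsEmbedding P ℱ S τ U V J μ m Q₀ k Z) :
    ∃ Z', IsEmbedding P ℱ S τ U V J μ m Q₀ (k + 1) Z' := by
  set Q := P.withDensity Z with hQ
  have hZm : Measurable Z := hZ.measurable.mono (ℱ.le _) le_rfl
  have hJk (j : ℕ) (hj : j ≤ k) : Measurable[ℱ (τ k)] (J j) := (hJ j).mono (ℱ.mono (hτm hj)) le_rfl
  choose g hgm hgtop hg hgpos using fun i i' : I =>
    hCFS.exists_condProb_tubeEvent hSa hτ (hU i) (hUc i) (hV i')
  let A : (Fin (k + 1 + 1) → I) → Set Ω := fun c =>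
    tubeEvent S (τ k) (τ (k + 1)) (U (extendPath c k)) (V (extendPath c (k + 1)))
  let H : (Fin (k + 1 + 1) → I) → Set Ω := fun c => historyEvent J k (extendPath c)
  -- For an impossible history this is `0 / 0 = 0` in `ENNReal`, so `hp` needs no exception.
  let p : (Fin (k + 1 + 1) → I) → ENNReal := fun c =>
    μ (historyEvent m (k + 1) (extendPath c)) / μ (historyEvent m k (extendPath c))
  have hEJ {c : Fin (k + 1 + 1) → I} {ω : Ω} (hω : ω ∈ A c ∩ H c) :
      ω ∈ historyEvent J (k + 1) (extendPath c) := by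
    intro j hj
    rcases Nat.lt_or_eq_of_le hj with hj | rfl
    · exact hω.2 j (Nat.lt_succ_iff.1 hj)
    · exact hJV _ _ _ hω.1.2
  have hEuniq {c : Fin (k + 1 + 1) → I} {ω : Ω} (hω : ω ∈ A c ∩ H c) {h : ℕ → I}
      (hh : ω ∈ historyEvent J (k + 1) h) : c = fun j : Fin (k + 1 + 1) => h j :=
    eq_of_extendPath_eq fun j hj => by
      rw [← hEJ hω j hj, hh j hj, extendPath_restrict h hj]
  have hp (h : ℕ → I) : p (fun j => h j) * μ (historyEvent m k h) =
      μ (historyEvent m (k + 1) h) := by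
    simp only [p]
    rw [historyEvent_congr m (k := k) fun j hj => extendPath_restrict h (hj.trans k.le_succ),
      historyEvent_congr m (k := k + 1) fun j hj => extendPath_restrict h hj]
    refine ENNReal.div_mul_cancel' (fun h0 => ?_) fun h0 => absurd h0 (measure_ne_top _ _)
    exact measure_mono_null (historyEvent_succ_subset m k h) h0
  obtain ⟨Z', hZ'm, hac, hagree, hcond, hex⟩ := exists_change_of_measure (P := P) (p := p)
    (A := A) (H := H) (g := fun c => g (extendPath c k) (extendPath c (k + 1)))
    (ℱ.mono (hτm k.le_succ)) (ℱ.le (τ (k + 1))) hZ.measurable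
    (fun c => measurableSet_tubeEvent hS hSa _ _ (hU _) (hV _))
    (fun c => measurableSet_historyEvent (mΩ := ℱ (τ k)) hJk _)
    (fun c c' hcc => Set.disjoint_left.2 fun ω h h' => hcc (eq_of_extendPath_eq fun j hj => by
      rw [← hEJ h j hj, ← hEJ h' j hj]))
    (fun c => hgm _ _) (fun c => hg _ _) (fun c => hgtop _ _)
    (fun c hc => by
      have hμ : μ (historyEvent m (k + 1) (extendPath c)) ≠ 0 := fun h0 => hc (by simp [p, h0])
      filter_upwards [hgpos _ _ (htrans _ hμ), (ae_withDensity_iff hZm).1 hZ.mem_target]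
        with ω h1 h2 hω hZω
      refine h1 ?_
      have := hVU _ (h2 hZω)
      rwa [hω k le_rfl] at this)
    (by
      filter_upwards [ae_measure_historyEvent_ne_zero hZ.law] with ω hw
      -- Only the continuations of the realised history contribute, and their conditional
      -- probabilities under `μ` add up to one because `E` is almost surely not null.
      set E := historyEvent m k fun j => J j ω with hE
      have hterm (c : Fin (k + 1 + 1) → I) : (H c).indicator (fun _ => p c) ω =
          μ (E ∩ historyEvent m (k + 1) (extendPath c)) * (μ E)⁻¹ := by
        by_cases hc : ω ∈ H c
        · have hEc : historyEvent m k (extendPath c) = E :=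
            historyEvent_congr m fun j hj => (hc j hj).symm
          rw [Set.indicator_of_mem hc, Set.inter_eq_right.2
            ((historyEvent_succ_subset m k _).trans hEc.subset)]
          simp only [p, hEc, div_eq_mul_inv]
        · have hem : E ∩ historyEvent m (k + 1) (extendPath c) = ∅ := by
            refine Set.eq_empty_iff_forall_notMem.2 fun ω' h' => hc fun j hj => ?_
            rw [← h'.2 j (hj.trans k.le_succ), h'.1 j hj]
          rw [Set.indicator_of_notMem hc, hem, measure_empty, zero_mul]
      simp_rw [hterm]
      rw [← Finset.sum_mul, sum_measure_inter_historyEvent μ hm _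
        (measurableSet_historyEvent (fun j _ => hm j) _)]
      exact ENNReal.mul_inv_cancel hw (measure_ne_top _ _))
  have hnew (h : ℕ → I) (B : Set Ω) (hB : MeasurableSet[ℱ (τ k)] B) :
      P.withDensity Z' (B ∩ historyEvent J (k + 1) h) =
        p (fun j => h j) * Q (B ∩ historyEvent J k h) := by
    have hH : H (fun j => h j) = historyEvent J k h :=
      historyEvent_congr J fun j hj => extendPath_restrict h (hj.trans k.le_succ)
    rw [← hH, ← hcond _ B hB]
    refine measure_congr ?_
    filter_upwards [hex] with ω hω
    obtain ⟨c, -, hc⟩ := hω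
    refine propext (and_congr_right fun _ => ⟨fun hh => ?_, fun hh => ?_⟩)
    · rw [hEuniq hc hh] at hc
      exact hc
    · have := hEJ hh
      rwa [historyEvent_congr J fun j hj => extendPath_restrict h hj] at this
  refine ⟨Z', hZ'm, hac.trans hZ.absolutelyContinuous, fun h => ?_, ?_, ?_, fun j hj h B hB => ?_⟩
  · have := hnew h Set.univ .univ
    rwa [Set.univ_inter, Set.univ_inter, hZ.law, hp] at this
  · filter_upwards [hex] with ω ⟨c, _, hc⟩
    rw [hEJ hc (k + 1) le_rfl]
    exact hc.1.2
  · filter_upwards [hex, hac.ae_le hZ.mem_tube] with ω ⟨c, _, hc⟩ hold j hj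
    rcases Nat.lt_or_eq_of_le (Nat.lt_succ_iff.1 hj) with hj | rfl
    · exact hold j hj
    · rw [hEJ hc j j.le_succ]
      exact hc.1.1
  · rcases Nat.lt_or_eq_of_le (Nat.lt_succ_iff.1 hj) with hj | rfl
    · have hB' : MeasurableSet[ℱ (τ k)] B := ℱ.mono (hτm hj.le) B hB
      rw [hagree _ (hB'.inter (measurableSet_historyEvent (mΩ := ℱ (τ k))
          (fun i hi => hJk i (hi.trans hj)) h)),
        hagree _ (hB'.inter (measurableSet_historyEvent (mΩ := ℱ (τ k))
          (fun i hi => hJk i (hi.trans hj.le)) h))]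
      exact hZ.cond j hj h B hB
    · rw [hnew h B hB, hagree _ (hB.inter (measurableSet_historyEvent (mΩ := ℱ (τ j)) hJk h)),
        mul_right_comm, hp, mul_comm]

theorem IsEmbedding.exists_of_zero [Fintype I] [MeasurableSpace I] [MeasurableSingletonClass I]
    {P : Measure Ω} [IsFiniteMeasure P] {ℱ : Filtration (TimeInterval T) mΩ}
    {S : TimeInterval T → Ω → Orthant d} {hS : ∀ ω, Continuous fun u => S u ω}
    (hCFS : ConditionalFullSupport P ℱ S hS) (hSa : Adapted ℱ S)
    {τ : ℕ → TimeInterval T} (hτm : Monotone τ) {U V : I → Set (Fin d → ℝ)}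
    (hU : ∀ i, IsOpen (U i)) (hUc : ∀ i, Convex ℝ (U i)) (hV : ∀ i, IsOpen (V i))
    (hVU : ∀ i, V i ⊆ U i) {J : ℕ → Ω → I} (hJ : ∀ k, Measurable[ℱ (τ k)] (J k))
    (hJV : ∀ k ω i, (S (τ k) ω : Fin d → ℝ) ∈ V i → J k ω = i)
    {μ : Measure Ω'} [IsProbabilityMeasure μ] {m : ℕ → Ω' → I} (hm : ∀ j, Measurable (m j))
    {Q₀ : Measure Ω} {N : ℕ} (hτ : ∀ k < N, τ k < τ (k + 1))
    (htrans : ∀ k < N, ∀ h, μ (historyEvent m (k + 1) h) ≠ 0 →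
      ∃ v : Orthant d, (v : Fin d → ℝ) ∈ U (h k) ∩ V (h (k + 1)))
    {Z : Ω → ENNReal} (hZ : IsEmbedding P ℱ S τ U V J μ m Q₀ 0 Z) :
    ∃ Z', IsEmbedding P ℱ S τ U V J μ m Q₀ N Z' := by
  have key (k : ℕ) (hk : k ≤ N) : ∃ Z', IsEmbedding P ℱ S τ U V J μ m Q₀ k Z' := by
    induction k with
    | zero => exact ⟨Z, hZ⟩
    | succ k ih =>
      obtain ⟨Z', hZ'⟩ := ih (k.le_succ.trans hk)
      exact hZ'.succ hCFS hSa hτm hU hUc hV hVU hJ hJV hm (hτ k hk) (htrans k hk)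
  exact key N le_rfl

end Embedding

/-! ### Conditional laws under conditional independence -/

section ConditionalLaws

/-- If `X` takes finitely many values and `Y` is conditionally independent of `W` given `X`, which
is a function of `W`, then the conditional laws of `Y` given `W` and given `X` agree. -/
theorem condDistrib_ae_eq_condDistrib_comp {α β γ E : Type*} {mα : MeasurableSpace α}
    {mβ : MeasurableSpace β} {mγ : MeasurableSpace γ} [MeasurableSingletonClass γ]
    [MeasurableSpace E] [StandardBorelSpace E] [Nonempty E] {μ : Measure α} [IsFiniteMeasure μ]
    {W : α → β} (hW : Measurable W) {X : β → γ} (hX : Measurable X) {Y : α → E}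
    (hY : Measurable Y) (F : Finset γ) (hF : ∀ᵐ a ∂μ, X (W a) ∈ F)
    (hind : ∀ v ∈ F, ∀ B, MeasurableSet B → ∀ C, MeasurableSet C →
      μ (W ⁻¹' B ∩ (X ∘ W) ⁻¹' {v} ∩ Y ⁻¹' C) * μ ((X ∘ W) ⁻¹' {v}) =
        μ (W ⁻¹' B ∩ (X ∘ W) ⁻¹' {v}) * μ ((X ∘ W) ⁻¹' {v} ∩ Y ⁻¹' C)) :
    ∀ᵐ a ∂μ, condDistrib Y W μ (W a) = condDistrib Y (X ∘ W) μ (X (W a)) := by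
  have hXW := hX.comp hW
  have hsplit {A : Set α} (hA : MeasurableSet A) {f : α → ENNReal} :
      ∫⁻ a in A, f a ∂μ = ∑ v ∈ F, ∫⁻ a in A ∩ (X ∘ W) ⁻¹' {v}, f a ∂μ := by
    rw [← lintegral_biUnion_finset]
    · refine setLIntegral_congr ?_
      filter_upwards [hF] with a ha
      refine propext ⟨fun h => ?_, fun h => ?_⟩
      · exact Set.mem_biUnion (show X (W a) ∈ (F : Set γ) from ha) ⟨h, rfl⟩
      · obtain ⟨v, -, hv, -⟩ := Set.mem_iUnion₂.1 h
        exact hv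
    · intro v _ v' _ hvv
      refine Set.disjoint_left.2 fun a h h' => hvv ?_
      exact h.2.symm.trans h'.2
    · exact fun v _ => hA.inter (hXW (measurableSet_singleton v))
  have hκ : μ.map (fun a => (W a, Y a)) =
      μ.map W ⊗ₘ (condDistrib Y (X ∘ W) μ).comap X hX := by
    refine Measure.ext_prod fun {B C} hB hC => ?_
    rw [Measure.compProd_apply_prod hB hC, Measure.map_apply (hW.prodMk hY) (hB.prod hC),
      setLIntegral_map hB (Kernel.measurable_coe _ hC) hW, Set.mk_preimage_prod]
    have hA := (hW hB).inter (hY hC)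
    have h1 : μ (W ⁻¹' B ∩ Y ⁻¹' C) = ∫⁻ a in W ⁻¹' B ∩ Y ⁻¹' C, 1 ∂μ := by simp
    rw [h1, hsplit hA, hsplit (hW hB)]
    refine Finset.sum_congr rfl fun v hv => ?_
    have hset : W ⁻¹' B ∩ Y ⁻¹' C ∩ (X ∘ W) ⁻¹' {v} = W ⁻¹' B ∩ (X ∘ W) ⁻¹' {v} ∩ Y ⁻¹' C := by
      ext a
      simp only [Set.mem_inter_iff]
      tauto
    have h2 : ∫⁻ a in W ⁻¹' B ∩ (X ∘ W) ⁻¹' {v},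
        (condDistrib Y (X ∘ W) μ).comap X hX (W a) C ∂μ =
        condDistrib Y (X ∘ W) μ v C * μ (W ⁻¹' B ∩ (X ∘ W) ⁻¹' {v}) := by
      rw [← setLIntegral_const]
      refine setLIntegral_congr_fun ((hW hB).inter (hXW (measurableSet_singleton v)))
        fun a ha => ?_
      rw [Kernel.comap_apply, show X (W a) = v from ha.2]
    have h3 : condDistrib Y (X ∘ W) μ v C * μ ((X ∘ W) ⁻¹' {v}) =
        μ ((X ∘ W) ⁻¹' {v} ∩ Y ⁻¹' C) := by
      rw [← setLIntegral_preimage_condDistrib hXW hY.aemeasurable hC (measurableSet_singleton v),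
        ← setLIntegral_const]
      refine setLIntegral_congr_fun (hXW (measurableSet_singleton v)) fun a ha => ?_
      rw [show (X ∘ W) a = v from ha]
    rw [h2, hset]
    simp only [lintegral_const, one_mul, MeasurableSet.univ, Measure.restrict_apply,
      Set.univ_inter]
    rcases eq_or_ne (μ ((X ∘ W) ⁻¹' {v})) 0 with h0 | h0
    · have h4 : μ (W ⁻¹' B ∩ (X ∘ W) ⁻¹' {v}) = 0 := measure_mono_null Set.inter_subset_right h0
      rw [h4, mul_zero, measure_mono_null Set.inter_subset_left h4]
    · rw [← ENNReal.mul_left_inj h0 (measure_ne_top _ _), hind v hv B hB C hC, ← h3]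
      ring
  have := condDistrib_ae_eq_of_measure_eq_compProd_of_measurable hW hY hκ
  filter_upwards [ae_of_ae_map hW.aemeasurable this] with a ha
  rw [ha, Kernel.comap_apply]

end ConditionalLaws

/-! ### Laws and martingale property of the embedded values -/

section EmbeddedValues

theorem historyEvent_inter_preimage {Ω I : Type*} (J : ℕ → Ω → I) (k : ℕ) (h : ℕ → I) (i : I) :
    historyEvent J k h ∩ J (k + 1) ⁻¹' {i} =
      historyEvent J (k + 1) (Function.update h (k + 1) i) := by
  ext ω
  constructor
  · rintro ⟨h1, h2⟩ j hj
    rcases Nat.lt_or_eq_of_le hj with hj | rfl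
    · rw [Function.update_of_ne hj.ne]
      exact h1 j (Nat.lt_succ_iff.1 hj)
    · rw [Function.update_self]
      exact h2
  · intro hω
    refine ⟨fun j hj => ?_, ?_⟩
    · rw [hω j (hj.trans k.le_succ), Function.update_of_ne (Nat.lt_succ_of_le hj).ne]
    · have := hω (k + 1) le_rfl
      rwa [Function.update_self] at this

theorem historyEvent_update {Ω I : Type*} (J : ℕ → Ω → I) (k : ℕ) (h : ℕ → I) (i : I) :
    historyEvent J k (Function.update h (k + 1) i) = historyEvent J k h :=
  historyEvent_congr J fun _ hj => Function.update_of_ne (Nat.lt_succ_of_le hj).ne _ _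

theorem historyEvent_inter_of_agree {Ω I : Type*} (J : ℕ → Ω → I) {k n : ℕ} (hk : k ≤ n)
    {h h' : ℕ → I} (hh : ∀ j ≤ k, h j = h' j) :
    historyEvent J k h ∩ historyEvent J n h' = historyEvent J n h' :=
  Set.inter_eq_right.2 fun ω hω j hj => by rw [hω j (hj.trans hk), hh j hj]

theorem historyEvent_inter_of_not_agree {Ω I : Type*} (J : ℕ → Ω → I) {k n : ℕ} (hk : k ≤ n)
    {h h' : ℕ → I} (hh : ¬ ∀ j ≤ k, h j = h' j) :
    historyEvent J k h ∩ historyEvent J n h' = ∅ :=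
  Set.eq_empty_iff_forall_notMem.2 fun ω hω => hh fun j hj => by
    rw [← hω.1 j hj, hω.2 j (hj.trans hk)]

theorem setIntegral_comp_eq_sum {Ω I : Type*} [Fintype I] [MeasurableSpace I]
    [MeasurableSingletonClass I] {mΩ : MeasurableSpace Ω} {Q : Measure Ω} [IsFiniteMeasure Q]
    {K : Ω → I} (hK : Measurable K) (x : I → ℝ) {E : Set Ω} (hE : MeasurableSet E) :
    ∫ ω in E, x (K ω) ∂Q = ∑ i, x i * Q.real (E ∩ K ⁻¹' {i}) := by
  have h : ∀ i, ∫ ω in E ∩ K ⁻¹' {i}, x (K ω) ∂Q = x i * Q.real (E ∩ K ⁻¹' {i}) := by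
    intro i
    rw [setIntegral_congr_fun (g := fun _ => x i) (hE.inter (hK (measurableSet_singleton i)))
      fun ω hω => by rw [show K ω = i from hω.2], setIntegral_const, smul_eq_mul, mul_comm]
  simp_rw [← h]
  rw [← integral_iUnion_fintype]
  · congr 2
    ext ω
    simp
  · exact fun i => hE.inter (hK (measurableSet_singleton i))
  · intro i i' hii
    exact Set.disjoint_left.2 fun ω h h' => hii (h.2.symm.trans h'.2)
  · exact fun i => (Integrable.of_finite.comp_measurable hK).integrableOn

variable {Ω Ω' I : Type*} {mΩ : MeasurableSpace Ω} {mΩ' : MeasurableSpace Ω'} {d : ℕ} {T : ℝ}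
  [Fintype I] [MeasurableSpace I] [MeasurableSingletonClass I]
  {P : Measure Ω} {ℱ : Filtration (TimeInterval T) mΩ}
  {S : TimeInterval T → Ω → Orthant d} {τ : ℕ → TimeInterval T} {U V : I → Set (Fin d → ℝ)}
  {J : ℕ → Ω → I} {μ : Measure Ω'} {m : ℕ → Ω' → I} {Q₀ : Measure Ω}
  {N : ℕ} {Z : Ω → ENNReal}

theorem IsEmbedding.isProbabilityMeasure [IsProbabilityMeasure μ]
    (hZ : IsEmbedding P ℱ S τ U V J μ m Q₀ N Z)
    (hJ : ∀ k, Measurable (J k)) (hm : ∀ j, Measurable (m j)) :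
    IsProbabilityMeasure (P.withDensity Z) := by
  constructor
  rw [← sum_measure_inter_historyEvent _ hJ N .univ]
  simp_rw [Set.univ_inter, hZ.law]
  have := sum_measure_inter_historyEvent μ hm N .univ
  simp_rw [Set.univ_inter] at this
  rw [this, measure_univ]

/-- A shorter history is the disjoint union of its continuations up to time `N`, where the laws
agree. -/
theorem IsEmbedding.law_of_le (hZ : IsEmbedding P ℱ S τ U V J μ m Q₀ N Z)
    (hJ : ∀ k, Measurable (J k)) (hm : ∀ j, Measurable (m j)) {k : ℕ} (hk : k ≤ N)
    (h : ℕ → I) : P.withDensity Z (historyEvent J k h) = μ (historyEvent m k h) := by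
  rw [← sum_measure_inter_historyEvent _ hJ N (measurableSet_historyEvent (fun j _ => hJ j) h),
    ← sum_measure_inter_historyEvent _ hm N (measurableSet_historyEvent (fun j _ => hm j) h)]
  refine Finset.sum_congr rfl fun c _ => ?_
  by_cases hc : ∀ j ≤ k, h j = extendPath c j
  · rw [historyEvent_inter_of_agree J hk hc, historyEvent_inter_of_agree m hk hc, hZ.law]
  · rw [historyEvent_inter_of_not_agree J hk hc, historyEvent_inter_of_not_agree m hk hc,
      measure_empty, measure_empty]

theorem sum_measureReal_inter_historyEvent {Q : Measure Ω} [IsFiniteMeasure Q]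
    (hJ : ∀ j, Measurable (J j)) (n : ℕ) {E : Set Ω} (hE : MeasurableSet E) :
    ∑ c : Fin (n + 1) → I, Q.real (E ∩ historyEvent J n (extendPath c)) = Q.real E := by
  simp_rw [measureReal_def]
  rw [← sum_measure_inter_historyEvent Q hJ n hE, ENNReal.toReal_sum fun _ _ => measure_ne_top _ _]

/-- Split an event `B` of `ℱ (τ k)` along the histories. On each one the field `cond` makes the next
state independent of `B`, so the discrete martingale identity for `m` transfers to the big
filtration. Null histories contribute zero to both sides. -/
theorem IsEmbedding.condExp_succ (hZ : IsEmbedding P ℱ S τ U V J μ m Q₀ N Z)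
    [IsProbabilityMeasure (P.withDensity Z)]
    (hJ : ∀ k, Measurable[ℱ (τ k)] (J k)) (hm : ∀ j, Measurable (m j)) {k : ℕ} (hk : k < N)
    {x : I → ℝ} (hmart : ∀ h, ∑ i, x i * μ.real (historyEvent m k h ∩ m (k + 1) ⁻¹' {i}) =
      x (h k) * μ.real (historyEvent m k h)) :
    (fun ω => x (J k ω)) =ᵐ[P.withDensity Z]
      (P.withDensity Z)[fun ω => x (J (k + 1) ω) | ℱ (τ k)] := by
  set Q := P.withDensity Z with hQ
  have hJ' (k : ℕ) : Measurable (J k) := (hJ k).mono (ℱ.le _) le_rfl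
  have hint (k : ℕ) : Integrable (fun ω => x (J k ω)) Q :=
    Integrable.of_finite.comp_measurable (hJ' k)
  refine ae_eq_condExp_of_forall_setIntegral_eq (ℱ.le _) (hint _)
    (fun _ _ _ => (hint _).integrableOn) (fun B hB _ => ?_)
    ((measurable_of_countable x).comp (hJ k)).stronglyMeasurable.aestronglyMeasurable
  have hB' := ℱ.le _ B hB
  have hexp (j : ℕ) : ∫ ω in B, x (J j ω) ∂Q = ∑ c : Fin (k + 1) → I,
      ∑ i, x i * Q.real (B ∩ J j ⁻¹' {i} ∩ historyEvent J k (extendPath c)) := by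
    rw [setIntegral_comp_eq_sum (hJ' j) x hB', Finset.sum_comm]
    refine Finset.sum_congr rfl fun i _ => ?_
    rw [← Finset.mul_sum, sum_measureReal_inter_historyEvent hJ' k
      (hB'.inter (hJ' j (measurableSet_singleton i)))]
  rw [hexp, hexp]
  refine Finset.sum_congr rfl fun c _ => ?_
  set h := extendPath c with hh
  have hleft : ∑ i, x i * Q.real (B ∩ J k ⁻¹' {i} ∩ historyEvent J k h) =
      x (h k) * Q.real (B ∩ historyEvent J k h) := by
    rw [Finset.sum_eq_single (h k)]
    · congr 2
      ext ω
      simp only [Set.mem_inter_iff, Set.mem_preimage, Set.mem_singleton_iff]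
      exact ⟨fun h => ⟨h.1.1, h.2⟩, fun h => ⟨⟨h.1, h.2 k le_rfl⟩, h.2⟩⟩
    · intro i _ hi
      have : B ∩ J k ⁻¹' {i} ∩ historyEvent J k h = ∅ :=
        Set.eq_empty_iff_forall_notMem.2 fun ω hω => hi (hω.1.2.symm.trans (hω.2 k le_rfl))
      rw [this, measureReal_empty, mul_zero]
    · simp
  rw [hleft]
  have hlaw : Q.real (historyEvent J k h) = μ.real (historyEvent m k h) := by
    rw [measureReal_def, measureReal_def, hZ.law_of_le hJ' hm hk.le]
  rcases eq_or_ne (μ.real (historyEvent m k h)) 0 with h0 | h0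
  · rw [h0] at hlaw
    have hnull (A : Set Ω) (hA : A ⊆ historyEvent J k h) : Q.real A = 0 :=
      measureReal_mono_null hA hlaw
    rw [hnull _ Set.inter_subset_right, mul_zero]
    exact (Finset.sum_eq_zero fun i _ => by rw [hnull _ Set.inter_subset_right, mul_zero]).symm
  · refine mul_right_cancel₀ h0 ?_
    rw [mul_right_comm, ← hmart h, Finset.sum_mul, Finset.sum_mul]
    refine Finset.sum_congr rfl fun i _ => ?_
    have hset : B ∩ J (k + 1) ⁻¹' {i} ∩ historyEvent J k h =
        B ∩ historyEvent J (k + 1) (Function.update h (k + 1) i) := by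
      rw [← historyEvent_inter_preimage, Set.inter_assoc, Set.inter_comm (J (k + 1) ⁻¹' {i})]
    have hc := congrArg ENNReal.toReal (hZ.cond k hk (Function.update h (k + 1) i) B hB)
    rw [ENNReal.toReal_mul, ENNReal.toReal_mul, historyEvent_update, historyEvent_update] at hc
    rw [hset, historyEvent_inter_preimage, mul_assoc, mul_assoc]
    congr 1
    rw [mul_comm (μ.real _)]
    exact hc.symm

theorem condExp_eq_of_condExp_succ {Q : Measure Ω} [IsProbabilityMeasure Q] (hτ : Monotone τ)
    {X : ℕ → Ω → ℝ} (hX : ∀ k, StronglyMeasurable[ℱ (τ k)] (X k)) (hint : ∀ k, Integrable (X k) Q)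
    (hsucc : ∀ k < N, X k =ᵐ[Q] Q[X (k + 1) | ℱ (τ k)]) {k : ℕ} (hk : k ≤ N) :
    X k =ᵐ[Q] Q[X N | ℱ (τ k)] := by
  induction hk using Nat.decreasingInduction with
  | self => rw [condExp_of_stronglyMeasurable (ℱ.le _) (hX N) (hint N)]
  | of_succ k hk ih =>
    calc X k =ᵐ[Q] Q[X (k + 1) | ℱ (τ k)] := hsucc k hk
      _ =ᵐ[Q] Q[Q[X N | ℱ (τ (k + 1))] | ℱ (τ k)] := condExp_congr_ae ih
      _ =ᵐ[Q] Q[X N | ℱ (τ k)] := condExp_condExp_of_le (ℱ.mono (hτ k.le_succ)) (ℱ.le _)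

end EmbeddedValues

/-! ### Vector-valued closed martingales -/

section VectorMartingale

variable {Ω : Type*} {mΩ : MeasurableSpace Ω} {T : ℝ} {d : ℕ}

/-- The closed martingale generated by a bounded random vector has a bounded càdlàg version. -/
theorem exists_cadlag_martingale {Q : Measure Ω} [IsProbabilityMeasure Q]
    (ℱ : Filtration (TimeInterval T) mΩ) (hℱ : ℱ.IsRightContinuous) {X : Ω → Fin d → ℝ}
    (hX : Measurable X) {c C : ℝ} (hcC : c ≤ C) (hXb : ∀ ω j, X ω j ∈ Set.Icc c C) :
    ∃ Y : TimeInterval T → Ω → Fin d → ℝ, Martingale Y ℱ Q ∧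
      (∀ t ω j, Y t ω j ∈ Set.Icc c C) ∧
      (∀ t j, (fun ω => Y t ω j) =ᵐ[Q] Q[fun ω => X ω j | ℱ t]) ∧
      ∀ᵐ ω ∂Q, IsCadlag fun t => Y t ω := by
  have hXj (j : Fin d) : Measurable fun ω => X ω j := (measurable_pi_apply j).comp hX
  have hXint (j : Fin d) : Integrable (fun ω => X ω j) Q :=
    .of_mem_Icc c C (hXj j).aemeasurable (.of_forall fun ω => hXb ω j)
  choose Y hYm hYb hYX hYc using fun j => exists_cadlag_version ℱ hℱ (hXint j) hcC
    (.of_forall fun ω => (hXb ω j).1) (.of_forall fun ω => (hXb ω j).2)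
  have hm (t : TimeInterval T) : StronglyMeasurable[ℱ t] fun ω j => Y j t ω :=
    (@measurable_pi_lambda Ω (Fin d) (fun _ => ℝ) (ℱ t) _ _
      fun j => (hYm j t).measurable).stronglyMeasurable
  have hYint (t : TimeInterval T) (j : Fin d) : Integrable (Y j t) Q :=
    .of_mem_Icc c C ((hYm j t).mono (ℱ.le t)).measurable.aemeasurable
      (.of_forall fun ω => hYb j t ω)
  have hint (t : TimeInterval T) : Integrable (fun ω j => Y j t ω) Q :=
    Integrable.of_eval fun j => hYint t j
  refine ⟨fun t ω j => Y j t ω, ⟨hm, fun s t hst => ?_⟩, fun t ω j => hYb j t ω,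
    fun t j => hYX j t, ?_⟩
  · refine (ae_eq_condExp_of_forall_setIntegral_eq (ℱ.le s) (hint t)
      (fun _ _ _ => (hint s).integrableOn) (fun A hA _ => ?_) (hm s).aestronglyMeasurable).symm
    funext j
    rw [eval_integral fun j => (hYint s j).integrableOn,
      eval_integral fun j => (hYint t j).integrableOn]
    have key {r : TimeInterval T} (hr : s ≤ r) : ∫ ω in A, Y j r ω ∂Q = ∫ ω in A, X ω j ∂Q := by
      have hA' := ℱ.mono hr A hA
      rw [setIntegral_congr_ae (g := Q[fun ω => X ω j | ℱ r]) (ℱ.le r A hA')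
        ((hYX j r).mono fun ω h _ => h), setIntegral_condExp (ℱ.le r) (hXint j) hA']
    rw [key le_rfl, key hst]
  · filter_upwards [ae_all_iff.2 hYc] with ω hω t
    refine ⟨continuousWithinAt_pi.2 fun j => (hω j t).1, fun j => (hω j t).2.choose, ?_⟩
    exact tendsto_pi_nhds.2 fun j => (hω j t).2.choose_spec

/-- Closed bounds pass from a dense set of times to all times of a half-open interval. -/
theorem IsCadlag.mem_of_dense {f : TimeInterval T → Fin d → ℝ} (hf : IsCadlag f)
    {D : Set (TimeInterval T)} (hD : Dense D) {t b : TimeInterval T} (htb : t < b)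
    {K : Set (Fin d → ℝ)} (hK : IsClosed K) (h : ∀ q ∈ D, t ≤ q → q ≤ b → f q ∈ K) : f t ∈ K := by
  have := hD.nhdsWithin_inter_Ioi_neBot htb
  have hlim : Tendsto f (𝓝[D ∩ Set.Ioi t] t) (𝓝 (f t)) :=
    (hf t).1.mono fun q hq => Set.Ioi_subset_Ici_self hq.2
  refine hK.mem_of_tendsto hlim ?_
  filter_upwards [inter_mem_nhdsWithin _ (Iio_mem_nhds htb)] with q hq
  exact h q hq.1.1 (le_of_lt hq.1.2) (le_of_lt hq.2)

end VectorMartingale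

/-! ### Reaching the first target -/

section InitialStage

/-- A measurable function that identifies the members of a finite family of disjoint open sets. -/
theorem exists_measurable_selector {E I : Type*} [Countable I]
    [MeasurableSpace I] [TopologicalSpace E] [MeasurableSpace E]
    [OpensMeasurableSpace E] (i₀ : I) {W : I → Set E} (hW : ∀ i, IsOpen (W i))
    (hdisj : ∀ i i', i ≠ i' → Disjoint (W i) (W i')) :
    ∃ r : E → I, Measurable r ∧ ∀ i, ∀ y ∈ W i, r y = i := by
  classical
  let r : E → I := fun y => if h : ∃ i, y ∈ W i then h.choose else i₀
  have hr : ∀ i, ∀ y ∈ W i, r y = i := by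
    intro i y hy
    have h : ∃ i, y ∈ W i := ⟨i, hy⟩
    simp only [r, h, dite_true]
    by_contra hne
    exact Set.disjoint_left.1 (hdisj _ _ hne) h.choose_spec hy
  have hr₀ : ∀ y, (¬ ∃ i, y ∈ W i) → r y = i₀ := fun y hy => by simp only [r, hy, dite_false]
  refine ⟨r, measurable_to_countable' fun i => ?_, hr⟩
  have hWU : MeasurableSet (⋃ i, W i)ᶜ := (isOpen_iUnion hW).measurableSet.compl
  have : r ⁻¹' {i} = W i ∪ ({y | i = i₀} ∩ (⋃ i, W i)ᶜ) := by
    ext y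
    simp only [Set.mem_preimage, Set.mem_singleton_iff, Set.mem_union, Set.mem_inter_iff,
      Set.mem_ofPred_eq, Set.mem_compl_iff, Set.mem_iUnion]
    by_cases h : ∃ i, y ∈ W i
    · obtain ⟨i', hi'⟩ := h
      rw [hr i' y hi']
      constructor
      · rintro rfl
        exact .inl hi'
      · rintro (h | ⟨-, h⟩)
        · by_contra hne
          exact Set.disjoint_left.1 (hdisj _ _ hne) hi' h
        · exact absurd ⟨i', hi'⟩ h
    · rw [hr₀ y h]
      constructor
      · exact fun h' => .inr ⟨h'.symm, h⟩
      · rintro (h' | ⟨h', -⟩)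
        · exact absurd ⟨i, h'⟩ h
        · exact h'.symm
  rw [this]
  exact (hW i).measurableSet.union ((MeasurableSet.const _).inter hWU)

variable {Ω Ω' I : Type*} {mΩ : MeasurableSpace Ω} {mΩ' : MeasurableSpace Ω'} {d : ℕ} {T : ℝ}
  {P : Measure Ω} {ℱ : Filtration (TimeInterval T) mΩ}
  {S : TimeInterval T → Ω → Orthant d} {τ : ℕ → TimeInterval T} {U V : I → Set (Fin d → ℝ)}
  {J : ℕ → Ω → I} {μ : Measure Ω'} {m : ℕ → Ω' → I}

/-- The first stage: `S` is moved from its starting point into the target of `i₀`. -/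
theorem exists_initial_embedding [IsProbabilityMeasure P] {hS : ∀ ω, Continuous fun u => S u ω}
    (hCFS : ConditionalFullSupport P ℱ S hS) (hSa : Adapted ℱ S) {t₀ : TimeInterval T}
    (ht₀ : t₀ < τ 0) {s : Fin d → ℝ} (hs : ∀ᵐ ω ∂P, (S t₀ ω : Fin d → ℝ) = s) {i₀ : I}
    {U₀ : Set (Fin d → ℝ)} (hU₀ : IsOpen U₀) (hU₀c : Convex ℝ U₀) (hsU : s ∈ U₀)
    (hV : IsOpen (V i₀)) (hv : ∃ v : Orthant d, (v : Fin d → ℝ) ∈ U₀ ∩ V i₀)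
    (hJV : ∀ ω i, (S (τ 0) ω : Fin d → ℝ) ∈ V i → J 0 ω = i) [IsProbabilityMeasure μ]
    (hm : ∀ᵐ ω ∂μ, m 0 ω = i₀) :
    ∃ Z, IsEmbedding P ℱ S τ U V J μ m (P.withDensity Z) 0 Z ∧ P.withDensity Z ≪ P ∧
      ∀ᵐ ω ∂P.withDensity Z, ∀ u ∈ Set.Icc t₀ (τ 0), (S u ω : Fin d → ℝ) ∈ U₀ := by
  obtain ⟨g, hgm, hgtop, hg, hgpos⟩ := hCFS.exists_condProb_tubeEvent hSa ht₀ hU₀ hU₀c hV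
  -- With a single event and new probability one, the change of measure is conditioning on the tube
  -- event given the initial σ-algebra.
  obtain ⟨Z, hZm, hac, hagree, -, hex⟩ := exists_change_of_measure (κ := Unit) (P := P)
    (Z := fun _ => 1) (A := fun _ => tubeEvent S t₀ (τ 0) U₀ (V i₀)) (H := fun _ => Set.univ)
    (p := fun _ => 1) (g := fun _ => g) (ℱ.mono ht₀.le) (ℱ.le (τ 0)) measurable_const
    (fun _ => measurableSet_tubeEvent hS hSa _ _ hU₀ hV) (fun _ => .univ)
    (fun c c' hcc => absurd (Subsingleton.elim c c') hcc) (fun _ => hgm) (fun _ => hg)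
    (fun _ => hgtop)
    (fun _ _ => by
      filter_upwards [hgpos hv, hs] with ω h1 h2 _ _
      exact h1 (h2 ▸ hsU))
    (.of_forall fun ω => by simp)
  have hP : P.withDensity (fun _ => (1 : ENNReal)) = P := by
    rw [withDensity_const, one_smul]
  rw [hP] at hac hagree
  have htube : ∀ᵐ ω ∂P.withDensity Z, ω ∈ tubeEvent S t₀ (τ 0) U₀ (V i₀) := by
    filter_upwards [hex] with ω ⟨_, _, hω, _⟩ using hω
  have hprob : P.withDensity Z Set.univ = 1 := by rw [hagree _ .univ, measure_univ]
  have hJ0 : ∀ᵐ ω ∂P.withDensity Z, J 0 ω = i₀ := htube.mono fun ω hω => hJV ω _ hω.2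
  refine ⟨Z, ⟨hZm, .rfl, fun h => ?_, ?_, .of_forall fun ω j hj => absurd hj j.not_lt_zero,
    fun j hj => absurd hj j.not_lt_zero⟩, hac, htube.mono fun ω hω => hω.1⟩
  · by_cases hi : i₀ = h 0
    · have h1 : historyEvent J 0 h =ᵐ[P.withDensity Z] Set.univ := by
        filter_upwards [hJ0] with ω hω
        refine propext (iff_true_intro fun j hj => ?_)
        rw [Nat.le_zero.1 hj, hω, hi]
      have h2 : historyEvent m 0 h =ᵐ[μ] Set.univ := by
        filter_upwards [hm] with ω hω
        refine propext (iff_true_intro fun j hj => ?_)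
        rw [Nat.le_zero.1 hj, hω, hi]
      rw [measure_congr h1, measure_congr h2, hprob, measure_univ]
    · have h1 : P.withDensity Z (historyEvent J 0 h) = 0 := by
        refine measure_eq_zero_iff_ae_notMem.2 (hJ0.mono fun ω hω hh => hi ?_)
        rw [← hω, hh 0 le_rfl]
      have h2 : μ (historyEvent m 0 h) = 0 := by
        refine measure_eq_zero_iff_ae_notMem.2 (hm.mono fun ω hω hh => hi ?_)
        rw [← hω, hh 0 le_rfl]
      rw [h1, h2]
  · filter_upwards [htube, hJ0] with ω h1 h2
    rw [h2]
    exact h1.2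

end InitialStage

/-! ### Joint law and conditional laws of the embedded process -/

section EmbeddedLaws

variable {Ω Ω' I : Type*} {mΩ : MeasurableSpace Ω} {mΩ' : MeasurableSpace Ω'} {d : ℕ} {T : ℝ}
  [Fintype I] [MeasurableSpace I] [MeasurableSingletonClass I]
  {P : Measure Ω} {ℱ : Filtration (TimeInterval T) mΩ}
  {S : TimeInterval T → Ω → Orthant d} {τ : ℕ → TimeInterval T} {U V : I → Set (Fin d → ℝ)}
  {J : ℕ → Ω → I} {μ : Measure Ω'} {m : ℕ → Ω' → I} {Q₀ : Measure Ω}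
  {N : ℕ} {Z : Ω → ENNReal}

open scoped Classical in
theorem measure_inter_preimage_eq_sum (ν : Measure Ω) {K : Ω → I} (hK : Measurable K) {E : Set Ω}
    (hE : MeasurableSet E) (C : Set I) :
    ν (E ∩ K ⁻¹' C) = ∑ i with i ∈ C, ν (E ∩ K ⁻¹' {i}) := by
  rw [← measure_biUnion_finset]
  · congr 1
    ext ω
    simp
  · intro i _ i' _ hii
    exact Set.disjoint_left.2 fun ω h h' => hii (h.2.symm.trans h'.2)
  · exact fun i _ => hE.inter (hK (measurableSet_singleton i))

/-- Given the history up to `k`, the next state is independent of `ℱ (τ k)`, hence of any smaller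
`𝒢` that contains the history. By `hb`, `X` encodes exactly that history. The freedom in `𝒢` serves
`k = 0`, where the σ-algebra of interest is that of time 0, before `τ 0`. -/
theorem IsEmbedding.condLaw_eq (hZ : IsEmbedding P ℱ S τ U V J μ m Q₀ N Z)
    [IsProbabilityMeasure (P.withDensity Z)]
    (hJ : ∀ k, Measurable[ℱ (τ k)] (J k)) (hm : ∀ j, Measurable (m j))
    {k : ℕ} (hk : k < N) {γ E : Type*} [MeasurableSpace γ] [MeasurableSingletonClass γ]
    [MeasurableSpace E] [StandardBorelSpace E] [Nonempty E] {𝒢 : MeasurableSpace Ω}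
    (h𝒢 : 𝒢 ≤ ℱ (τ k)) {X : Ω → γ} (hX : Measurable[𝒢] X) {Y : Ω → E} (hY : Measurable[mΩ] Y)
    {x : I → E} (hYx : ∀ᵐ ω ∂P.withDensity Z, Y ω = x (J (k + 1) ω)) {b : (ℕ → I) → γ}
    (hb : ∀ h h', b h = b h' ↔ ∀ j ≤ k, h j = h' j)
    (hXb : ∀ᵐ ω ∂P.withDensity Z, X ω = b fun j => J j ω) :
    ∀ᵐ ω ∂P.withDensity Z, condLaw (P.withDensity Z) 𝒢 Y ω =
      condDistrib Y X (P.withDensity Z) (X ω) := by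
  classical
  set Q := P.withDensity Z with hQ
  have hJ' (k : ℕ) : Measurable[mΩ] (J k) := (hJ k).mono (ℱ.le _) le_rfl
  have h𝒢' : 𝒢 ≤ mΩ := h𝒢.trans (ℱ.le _)
  let F : Finset γ := Finset.univ.image fun c : Fin (k + 1) → I => b (extendPath c)
  refine @condDistrib_ae_eq_condDistrib_comp Ω Ω γ E mΩ 𝒢 _ _ _ _ _ Q _ id
    (measurable_id.mono h𝒢' le_rfl) X hX Y hY F ?_ ?_
  · filter_upwards [hXb] with ω hω
    simp only [F, Finset.mem_image, Finset.mem_univ, true_and, id]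
    exact ⟨fun j => J j ω, by rw [hω]; exact (hb _ _).2 fun j hj => extendPath_restrict (fun j => J j ω) hj⟩
  · intro v hv B hB C _
    obtain ⟨c, -, rfl⟩ := Finset.mem_image.1 hv
    set h := extendPath c with hh
    have hXh : (X ∘ id ⁻¹' {b h} : Set Ω) =ᵐ[Q] historyEvent J k h := by
      filter_upwards [hXb] with ω hω
      refine propext ?_
      change X ω = b h ↔ _
      rw [hω, hb]
      rfl
    have hYC : (Y ⁻¹' C : Set Ω) =ᵐ[Q] J (k + 1) ⁻¹' (x ⁻¹' C) := by
      filter_upwards [hYx] with ω hω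
      refine propext ?_
      change Y ω ∈ C ↔ x (J (k + 1) ω) ∈ C
      rw [hω]
    have hB' : MeasurableSet[ℱ (τ k)] B := h𝒢 B hB
    have hH := measurableSet_historyEvent (J := J) (k := k) (fun j _ => hJ' j) h
    have hlaw1 := hZ.law_of_le hJ' hm hk.le
    have hlaw2 := hZ.law_of_le hJ' hm (Nat.succ_le_of_lt hk)
    have hBeq : (id ⁻¹' B : Set Ω) =ᵐ[Q] B := ae_eq_refl _
    rw [measure_congr ((hBeq.inter hXh).inter hYC), measure_congr hXh,
      measure_congr (hBeq.inter hXh), measure_congr (hXh.inter hYC),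
      measure_inter_preimage_eq_sum Q (hJ' _) (((ℱ.le _) B hB').inter hH),
      measure_inter_preimage_eq_sum Q (hJ' _) hH, Finset.sum_mul, Finset.mul_sum]
    refine Finset.sum_congr rfl fun i _ => ?_
    have hc := hZ.cond k hk (Function.update h (k + 1) i) B hB'
    rw [historyEvent_update, historyEvent_update] at hc
    rw [Set.inter_assoc, historyEvent_inter_preimage, hlaw1, hlaw2]
    exact hc

theorem IsEmbedding.map_eq (hZ : IsEmbedding P ℱ S τ U V J μ m Q₀ N Z)
    (hJ : ∀ k, Measurable (J k)) (hm : ∀ j, Measurable (m j)) :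
    (P.withDensity Z).map (fun ω (k : Fin (N + 1)) => J k ω) =
      μ.map fun ω (k : Fin (N + 1)) => m k ω := by
  have hJm : Measurable fun ω (k : Fin (N + 1)) => J k ω := measurable_pi_lambda _ fun k => hJ k
  have hmm : Measurable fun ω (k : Fin (N + 1)) => m k ω := measurable_pi_lambda _ fun k => hm k
  refine Measure.ext_of_singleton fun c => ?_
  rw [Measure.map_apply hJm (measurableSet_singleton c),
    Measure.map_apply hmm (measurableSet_singleton c)]
  have key := hZ.law (extendPath c)
  convert key using 2
  · ext ω
    refine ⟨fun h j hj => ?_, fun h => eq_of_extendPath_eq fun j hj => ?_⟩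
    · rw [← show _ = c from h, extendPath_restrict (fun k => J k ω) hj]
    · rw [extendPath_restrict (fun k => J k ω) hj, h j hj]
  · ext ω
    refine ⟨fun h j hj => ?_, fun h => eq_of_extendPath_eq fun j hj => ?_⟩
    · rw [← show _ = c from h, extendPath_restrict (fun k => m k ω) hj]
    · rw [extendPath_restrict (fun k => m k ω) hj, h j hj]

end EmbeddedLaws

/-! ### The consistent price system -/

section PriceSystem

variable {Ω Ω' I : Type*} {mΩ : MeasurableSpace Ω} {mΩ' : MeasurableSpace Ω'} {d : ℕ} {T : ℝ}
  [Fintype I] [MeasurableSpace I] [MeasurableSingletonClass I]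
  {P : Measure Ω} {ℱ : Filtration (TimeInterval T) mΩ}
  {S : TimeInterval T → Ω → Orthant d} {τ : ℕ → TimeInterval T} {U V : I → Set (Fin d → ℝ)}
  {J : ℕ → Ω → I} {μ : Measure Ω'} {m : ℕ → Ω' → I} {Q₀ : Measure Ω}
  {N : ℕ} {Z : Ω → ENNReal}

/-- Between two grid times, the closed martingale generated by the last value of the embedded
process satisfies the bounds that hold for the next value. -/
theorem IsEmbedding.condExp_mem_Icc (hZ : IsEmbedding P ℱ S τ U V J μ m Q₀ N Z)
    [IsProbabilityMeasure (P.withDensity Z)]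
    (hJ : ∀ k, Measurable[ℱ (τ k)] (J k)) (hm : ∀ j, Measurable (m j)) (hτ : Monotone τ)
    {x l u : I → ℝ}
    (hmart : ∀ k < N, ∀ h, ∑ i, x i * μ.real (historyEvent m k h ∩ m (k + 1) ⁻¹' {i}) =
      x (h k) * μ.real (historyEvent m k h))
    {k : ℕ} (hk : k < N)
    (htrans : ∀ h, μ (historyEvent m (k + 1) h) ≠ 0 → x (h (k + 1)) ∈ Set.Icc (l (h k)) (u (h k)))
    {t : TimeInterval T} (hkt : τ k ≤ t) (htk : t ≤ τ (k + 1)) :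
    ∀ᵐ ω ∂P.withDensity Z,
      ((P.withDensity Z)[fun ω => x (J N ω) | ℱ t]) ω ∈ Set.Icc (l (J k ω)) (u (J k ω)) := by
  set Q := P.withDensity Z with hQ
  have hJ' (k : ℕ) : Measurable (J k) := (hJ k).mono (ℱ.le _) le_rfl
  have hint (y : I → ℝ) (k : ℕ) : Integrable (fun ω => y (J k ω)) Q :=
    Integrable.of_finite.comp_measurable (hJ' k)
  -- The bounds depend on `J k`, known at time `t ≥ τ k`, so they survive conditioning of the next
  -- value; the tower property then replaces the next value by the last one.
  have hself (y : I → ℝ) : Q[fun ω => y (J k ω) | ℱ t] = fun ω => y (J k ω) :=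
    condExp_of_stronglyMeasurable (ℱ.le t)
      ((measurable_of_countable y).comp ((hJ k).mono (ℱ.mono hkt) le_rfl)).stronglyMeasurable
      (hint y k)
  have hmem : ∀ᵐ ω ∂Q, x (J (k + 1) ω) ∈ Set.Icc (l (J k ω)) (u (J k ω)) := by
    filter_upwards [ae_measure_historyEvent_ne_zero (hZ.law_of_le hJ' hm (Nat.succ_le_of_lt hk))]
      with ω hω
    exact htrans _ hω
  have hlow : (fun ω => l (J k ω)) ≤ᵐ[Q] Q[fun ω => x (J (k + 1) ω) | ℱ t] := by
    rw [← hself l]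
    exact condExp_mono (hint _ _) (hint _ _) (hmem.mono fun ω h => h.1)
  have hup : Q[fun ω => x (J (k + 1) ω) | ℱ t] ≤ᵐ[Q] fun ω => u (J k ω) := by
    rw [← hself u]
    exact condExp_mono (hint _ _) (hint _ _) (hmem.mono fun ω h => h.2)
  have hX := condExp_eq_of_condExp_succ (N := N) (X := fun k ω => x (J k ω)) hτ
    (fun k => ((measurable_of_countable x).comp (hJ k)).stronglyMeasurable) (hint x)
    (fun k hk => hZ.condExp_succ hJ hm hk (hmart k hk)) (Nat.succ_le_of_lt hk)
  have htower : Q[fun ω => x (J (k + 1) ω) | ℱ t] =ᵐ[Q] Q[fun ω => x (J N ω) | ℱ t] :=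
    (condExp_congr_ae hX).trans (condExp_condExp_of_le (ℱ.mono htk) (ℱ.le _))
  filter_upwards [hlow, hup, htower] with ω h1 h2 h3
  rw [← h3]
  exact ⟨h1, h2⟩

theorem exists_grid_interval (τ : ℕ → TimeInterval T) {N : ℕ} {t : TimeInterval T} (h0 : τ 0 ≤ t)
    (hN : t < τ N) : ∃ k < N, τ k ≤ t ∧ t < τ (k + 1) := by
  induction N with
  | zero => exact absurd h0 hN.not_ge
  | succ n ih =>
    rcases lt_or_ge t (τ n) with h | h
    · obtain ⟨k, hk, h'⟩ := ih h
      exact ⟨k, hk.trans n.lt_succ_self, h'⟩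
    · exact ⟨n, n.lt_succ_self, h, hN⟩

/-- The price is the càdlàg martingale closed by `x (J N)`. Before `τ 0` it is the constant `s`,
since its value at `τ 0` is; afterwards the tubes and the conditional bounds combine. -/
theorem IsEmbedding.exists_priceSystem (hZ : IsEmbedding P ℱ S τ U V J μ m Q₀ N Z)
    [hprob : IsProbabilityMeasure (P.withDensity Z)] (hℱ : ℱ.IsRightContinuous)
    (hQ₀ : Q₀ ≪ P) (hJ : ∀ k, Measurable[ℱ (τ k)] (J k)) (hm : ∀ j, Measurable (m j))
    (hτ : Monotone τ) (hτN : ∀ t, t ≤ τ N) {t₀ : TimeInterval T} (ht₀ : ∀ t, t₀ ≤ t)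
    (hN : 0 < N) {x l u : I → Fin d → ℝ} {c C : ℝ} (hc : 0 < c) (hcC : c ≤ C)
    (hx : ∀ i j, x i j ∈ Set.Icc c C)
    (hmart : ∀ j, ∀ k < N, ∀ h, ∑ i, x i j * μ.real (historyEvent m k h ∩ m (k + 1) ⁻¹' {i}) =
      x (h k) j * μ.real (historyEvent m k h))
    (htrans : ∀ k < N, ∀ h, μ (historyEvent m (k + 1) h) ≠ 0 →
      ∀ j, x (h (k + 1)) j ∈ Set.Icc (l (h k) j) (u (h k) j))
    {s : Fin d → ℝ} (hJ₀ : ∀ᵐ ω ∂P.withDensity Z, x (J 0 ω) = s) {ε : ℝ}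
    (hU : ∀ i, ∀ y : Orthant d, (y : Fin d → ℝ) ∈ U i → ∀ z : Fin d → ℝ, (∀ j, 0 < z j) →
      (∀ j, z j ∈ Set.Icc (l i j) (u i j)) →
        ∀ j, 1 - ε < (y : Fin d → ℝ) j / z j ∧ (y : Fin d → ℝ) j / z j < 1 + ε)
    {U₀ : Set (Fin d → ℝ)}
    (hU₀ : ∀ y : Orthant d, (y : Fin d → ℝ) ∈ U₀ →
      ∀ j, 1 - ε < (y : Fin d → ℝ) j / s j ∧ (y : Fin d → ℝ) j / s j < 1 + ε)
    (hSU₀ : ∀ᵐ ω ∂Q₀, ∀ u ∈ Set.Icc t₀ (τ 0), (S u ω : Fin d → ℝ) ∈ U₀) :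
    ∃ Shat : TimeInterval T → Ω → Fin d → ℝ,
      IsConsistentPriceSystem P ℱ S ε Shat (P.withDensity Z) ∧
      (∀ k ≤ N, ∀ᵐ ω ∂P.withDensity Z, Shat (τ k) ω = x (J k ω)) ∧
      ∀ t ≤ τ 0, ∀ᵐ ω ∂P.withDensity Z, Shat t ω = s := by
  set Q := P.withDensity Z with hQ
  have hJ' (k : ℕ) : Measurable (J k) := (hJ k).mono (ℱ.le _) le_rfl
  have hint (j : Fin d) (k : ℕ) : Integrable (fun ω => x (J k ω) j) Q :=
    Integrable.of_finite.comp_measurable (g := fun i => x i j) (hJ' k)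
  obtain ⟨Shat, hmg, hb, hE, hcad⟩ := exists_cadlag_martingale (Q := Q) ℱ hℱ
    (X := fun ω => x (J N ω)) ((measurable_of_countable x).comp (hJ' N)) hcC
    (fun ω j => hx (J N ω) j)
  have hgrid (k : ℕ) (hk : k ≤ N) : ∀ᵐ ω ∂Q, Shat (τ k) ω = x (J k ω) := by
    have h (j : Fin d) : ∀ᵐ ω ∂Q, Shat (τ k) ω j = x (J k ω) j := by
      have hX := condExp_eq_of_condExp_succ (N := N) (X := fun k ω => x (J k ω) j) hτ
        (fun k => ((measurable_of_countable fun i => x i j).comp (hJ k)).stronglyMeasurable)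
        (hint j)
        (fun k hk => hZ.condExp_succ (x := fun i => x i j) hJ hm hk (hmart j k hk)) hk
      filter_upwards [hX, hE (τ k) j] with ω h1 h2
      rw [h1, h2]
    filter_upwards [ae_all_iff.2 h] with ω hω using funext hω
  have hinit (t : TimeInterval T) (ht : t ≤ τ 0) : ∀ᵐ ω ∂Q, Shat t ω = s := by
    have h0 : Shat (τ 0) =ᵐ[Q] fun _ => s := by
      filter_upwards [hgrid 0 N.zero_le, hJ₀] with ω h1 h2
      rw [h1, h2]
    have h1 := hmg.2 t (τ 0) ht
    have h2 : Q[Shat (τ 0) | ℱ t] =ᵐ[Q] fun _ => s := by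
      refine (condExp_congr_ae h0).trans ?_
      rw [condExp_const (ℱ.le t)]
    exact h1.symm.trans h2
  have hbound (k : ℕ) (hk : k < N) (t : TimeInterval T) (hkt : τ k ≤ t) (htk : t ≤ τ (k + 1)) :
      ∀ᵐ ω ∂Q, Shat t ω ∈ Set.Icc (l (J k ω)) (u (J k ω)) := by
    have h (j : Fin d) : ∀ᵐ ω ∂Q, Shat t ω j ∈ Set.Icc (l (J k ω) j) (u (J k ω) j) := by
      filter_upwards [hE t j, hZ.condExp_mem_Icc (x := fun i => x i j) (l := fun i => l i j)
        (u := fun i => u i j) hJ hm hτ (hmart j) hk (fun h hh => htrans k hk h hh j) hkt htk]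
        with ω h1 h2
      rw [h1]
      exact h2
    filter_upwards [ae_all_iff.2 h] with ω hω
    exact ⟨fun j => (hω j).1, fun j => (hω j).2⟩
  have : Nonempty (TimeInterval T) := ⟨t₀⟩
  obtain ⟨D, hDc, hD⟩ := TopologicalSpace.exists_countable_dense (TimeInterval T)
  -- The bounds hold almost surely at each fixed time, hence simultaneously on a countable set, and
  -- right-continuity extends them. The last time `τ N` cannot be approached from the right, so it
  -- is inserted by hand.
  have hall : ∀ᵐ ω ∂Q, ∀ q ∈ insert (τ N) D,
      (q ≤ τ 0 → Shat q ω = s) ∧ ∀ k < N, τ k ≤ q → q ≤ τ (k + 1) →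
        Shat q ω ∈ Set.Icc (l (J k ω)) (u (J k ω)) := by
    rw [ae_ball_iff (hDc.insert _)]
    intro q _
    rw [eventually_and]
    refine ⟨?_, ?_⟩
    · by_cases hq : q ≤ τ 0
      · exact (hinit q hq).mono fun ω h _ => h
      · exact .of_forall fun ω h => absurd h hq
    · rw [ae_all_iff]
      intro k
      by_cases hk : k < N ∧ τ k ≤ q ∧ q ≤ τ (k + 1)
      · exact (hbound k hk.1 q hk.2.1 hk.2.2).mono fun ω h _ _ _ => h
      · exact .of_forall fun ω h1 h2 h3 => absurd ⟨h1, h2, h3⟩ hk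
  have hpos (t : TimeInterval T) (ω : Ω) (j : Fin d) : 0 < Shat t ω j := hc.trans_le (hb t ω j).1
  refine ⟨Shat, ⟨hprob, hZ.absolutelyContinuous.trans hQ₀, hmg, hcad, hpos, ?_⟩, hgrid, hinit⟩
  filter_upwards [hcad, hall, hZ.mem_tube, hZ.absolutelyContinuous.ae_le hSU₀]
    with ω hω hq htube hSω t
  have hgridt (k : ℕ) (hk : k < N) (ht : t ∈ Set.Icc (τ k) (τ (k + 1)))
      (hmem : Shat t ω ∈ Set.Icc (l (J k ω)) (u (J k ω))) :=
    hU (J k ω) (S t ω) (htube k hk t ht) (Shat t ω) (hpos t ω) fun j => ⟨hmem.1 j, hmem.2 j⟩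
  rcases lt_or_ge t (τ 0) with h0 | h0
  · have : Shat t ω ∈ ({s} : Set (Fin d → ℝ)) :=
      hω.mem_of_dense hD h0 isClosed_singleton fun q hqD _ hq0 =>
        (hq q (Set.mem_insert_of_mem _ hqD)).1 hq0
    rw [show Shat t ω = s from this]
    exact hU₀ _ (hSω t ⟨ht₀ t, h0.le⟩)
  · rcases (hτN t).lt_or_eq with htN | htN
    · obtain ⟨k, hk, hkt, htk⟩ := exists_grid_interval τ h0 htN
      refine hgridt k hk ⟨hkt, htk.le⟩ (hω.mem_of_dense hD htk isClosed_Icc fun q hqD h1 h2 => ?_)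
      exact (hq q (Set.mem_insert_of_mem _ hqD)).2 k hk (hkt.trans h1) h2
    · obtain ⟨n, rfl⟩ := Nat.exists_eq_succ_of_ne_zero hN.ne'
      have h1 : τ n ≤ t := htN ▸ hτ n.le_succ
      refine hgridt n n.lt_succ_self ⟨h1, htN.le⟩ ?_
      rw [htN] at h1 ⊢
      exact (hq _ (Set.mem_insert _ _)).2 n n.lt_succ_self h1 le_rfl

end PriceSystem

/-! ### Choice of tubes and targets -/

section Targets

theorem exists_pos_forall_le_of_finite {κ : Type*} [Finite κ] {f : κ → ℝ} (hf : ∀ k, 0 < f k) :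
    ∃ c, 0 < c ∧ ∀ k, c ≤ f k := by
  obtain ⟨B, hB⟩ := (Set.finite_range fun k => (f k)⁻¹).bddAbove
  refine ⟨(max B 1)⁻¹, by positivity, fun k => ?_⟩
  rw [inv_le_comm₀ (by positivity) (hf k)]
  exact (hB ⟨k, rfl⟩).trans (le_max_left _ _)

/-- Points near which `S` can be kept while the martingale is at the values `x i`. -/
theorem exists_targets {I : Type*} [Finite I] {d : ℕ} {ε : ℝ} (hε : 0 < ε) {x : I → Fin d → ℝ}
    (hx : Function.Injective x) (hpos : ∀ i j, 0 < x i j) :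
    ∃ (y : I → Orthant d) (l u : I → Fin d → ℝ), Function.Injective y ∧ (∀ i j, 0 < l i j) ∧
      (∀ i j, (y i : Fin d → ℝ) j ∈ Set.Ioo ((1 - ε) * u i j) ((1 + ε) * l i j)) ∧
      (∀ i j, (y i : Fin d → ℝ) j ∈ Set.Ioo ((1 - ε) * x i j) ((1 + ε) * x i j)) ∧
      ∀ i i', (∀ j, x i' j ∈ Set.Ioo ((1 - ε / 3) * x i j) ((1 + ε / 3) * x i j)) → ∀ j,
        x i' j ∈ Set.Icc (l i j) (u i j) ∧
        (y i' : Fin d → ℝ) j ∈ Set.Ioo ((1 - ε) * u i j) ((1 + ε) * l i j) := by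
  rcases le_or_gt ε 1 with h1 | h1
  -- Finitely many relative steps are smaller than `ε / 3`, so they are at most some `δ < ε / 3`.
  -- This gap turns closed bounds into strict ones: `1 + δ < (1 + ε) (1 - δ)` means `δ < ε / (2 +
  -- ε)`, and `ε / 3 ≤ ε / (2 + ε)` precisely when `ε ≤ 1`.
  · let κ := {p : I × I × Fin d // |x p.2.1 p.2.2 / x p.1 p.2.2 - 1| < ε / 3}
    obtain ⟨c, hc, hcκ⟩ := exists_pos_forall_le_of_finite
      (f := fun p : κ => ε / 3 - |x p.1.2.1 p.1.2.2 / x p.1.1 p.1.2.2 - 1|)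
      (fun p => sub_pos.2 p.2)
    let δ := max (ε / 3 - c) 0
    have hδ0 : 0 ≤ δ := le_max_right _ _
    have hδ : δ < ε / 3 := max_lt (by linarith) (by linarith)
    have hbox (i : I) (j : Fin d) (z : ℝ) (hz : z ∈ Set.Icc ((1 - δ) * x i j) ((1 + δ) * x i j)) :
        z ∈ Set.Ioo ((1 - ε) * ((1 + δ) * x i j)) ((1 + ε) * ((1 - δ) * x i j)) := by
      have hxi := hpos i j
      have h2 : δ * ε ≤ δ := mul_le_of_le_one_right hδ0 h1
      have h3 : 0 ≤ δ * ε := mul_nonneg hδ0 hε.le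
      constructor
      · refine lt_of_lt_of_le ?_ hz.1
        rw [← mul_assoc]
        exact mul_lt_mul_of_pos_right (by nlinarith) hxi
      · refine lt_of_le_of_lt hz.2 ?_
        rw [← mul_assoc]
        exact mul_lt_mul_of_pos_right (by nlinarith) hxi
    have hself (i : I) (j : Fin d) : x i j ∈ Set.Icc ((1 - δ) * x i j) ((1 + δ) * x i j) := by
      have := mul_nonneg hδ0 (hpos i j).le
      constructor <;> linarith
    refine ⟨fun i => ⟨x i, hpos i⟩, fun i j => (1 - δ) * x i j, fun i j => (1 + δ) * x i j,
      fun i i' h => hx (congrArg Subtype.val h), fun i j => mul_pos (by linarith) (hpos i j),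
      fun i j => hbox i j _ (hself i j), fun i j => ?_, fun i i' h j => ?_⟩
    · have := mul_pos hε (hpos i j)
      constructor <;> simp only <;> linarith
    · have hxi := hpos i j
      have habs : |x i' j / x i j - 1| < ε / 3 := by
        rw [abs_lt, lt_sub_iff_add_lt, sub_lt_iff_lt_add, lt_div_iff₀ hxi, div_lt_iff₀ hxi]
        exact ⟨by linarith [(h j).1], by linarith [(h j).2]⟩
      have h4 : |x i' j / x i j - 1| ≤ δ := by
        have := hcκ ⟨(i, i', j), habs⟩
        simp only at this
        exact le_trans (by linarith) (le_max_left _ _)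
      have hmem : x i' j ∈ Set.Icc ((1 - δ) * x i j) ((1 + δ) * x i j) := by
        rw [abs_le, neg_le_sub_iff_le_add, sub_le_iff_le_add] at h4
        have h5 := (div_le_iff₀ hxi).1 h4.2
        have h6 : (1 - δ) * x i j ≤ x i' j := (le_div_iff₀ hxi).1 (by linarith [h4.1])
        exact ⟨h6, by linarith⟩
      exact ⟨hmem, hbox i j _ hmem⟩
  -- For `ε > 1` the lower bound on the ratio is negative, hence automatic. One box `[c, C]` serves
  -- all states, and scaling every value by `r` puts all target points at or below `c`, so below `(1
  -- + ε) c`.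
  · obtain ⟨c, hc, hcx⟩ := exists_pos_forall_le_of_finite
      (f := fun p : I × Fin d => x p.1 p.2) (fun p => hpos p.1 p.2)
    obtain ⟨B, hB⟩ := (Set.finite_range fun p : I × Fin d => x p.1 p.2).bddAbove
    let C := max B 1
    have hC : 0 < C := by positivity
    have hxC (i : I) (j : Fin d) : x i j ≤ C := (hB ⟨(i, j), rfl⟩).trans (le_max_left _ _)
    let r := min 1 (c / C)
    have hr : 0 < r := lt_min one_pos (div_pos hc hC)
    have hrx (i : I) (j : Fin d) : 0 < r * x i j := mul_pos hr (hpos i j)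
    have hrc (i : I) (j : Fin d) : r * x i j ≤ c := by
      calc r * x i j ≤ c / C * C :=
            mul_le_mul (min_le_right _ _) (hxC i j) (hpos i j).le (by positivity)
        _ = c := div_mul_cancel₀ c hC.ne'
    have hrx1 (i : I) (j : Fin d) : r * x i j ≤ x i j :=
      mul_le_of_le_one_left (hpos i j).le (min_le_left _ _)
    have hneg {a : ℝ} (ha : 0 < a) : (1 - ε) * a < 0 := mul_neg_of_neg_of_pos (by linarith) ha
    have hlt {a : ℝ} (ha : 0 < a) : a < (1 + ε) * a := by
      have := mul_pos hε ha
      linarith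
    have hbox (i : I) (j : Fin d) : r * x i j ∈ Set.Ioo ((1 - ε) * C) ((1 + ε) * c) :=
      ⟨(hneg hC).trans (hrx i j), (hrc i j).trans_lt (hlt hc)⟩
    refine ⟨fun i => ⟨fun j => r * x i j, hrx i⟩, fun _ _ => c, fun _ _ => C, fun i i' h => ?_,
      fun _ _ => hc, hbox, fun i j => ?_, fun i i' _ j => ⟨⟨hcx (i', j), hxC i' j⟩, hbox i' j⟩⟩
    · refine hx (funext fun j => mul_left_cancel₀ hr.ne' ?_)
      exact congrFun (congrArg Subtype.val h) j
    · exact ⟨(hneg (hpos i j)).trans (hrx i j), (hrx1 i j).trans_lt (hlt (hpos i j))⟩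

/-- The box `((1 - ε) u, (1 + ε) l)`. -/
def openBox {d : ℕ} (ε : ℝ) (l u : Fin d → ℝ) : Set (Fin d → ℝ) :=
  Set.univ.pi fun j => Set.Ioo ((1 - ε) * u j) ((1 + ε) * l j)

theorem isOpen_openBox {d : ℕ} (ε : ℝ) (l u : Fin d → ℝ) : IsOpen (openBox ε l u) :=
  isOpen_set_pi Set.finite_univ fun _ _ => isOpen_Ioo

theorem convex_openBox {d : ℕ} (ε : ℝ) (l u : Fin d → ℝ) : Convex ℝ (openBox ε l u) :=
  convex_pi fun _ _ => convex_Ioo _ _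

theorem div_mem_of_mem_openBox {d : ℕ} {ε : ℝ} (hε : 0 < ε) {l u : Fin d → ℝ} {y : Orthant d}
    (hy : (y : Fin d → ℝ) ∈ openBox ε l u) {z : Fin d → ℝ} (hz : ∀ j, 0 < z j)
    (hlu : ∀ j, z j ∈ Set.Icc (l j) (u j)) (j : Fin d) :
    1 - ε < (y : Fin d → ℝ) j / z j ∧ (y : Fin d → ℝ) j / z j < 1 + ε := by
  have hyj := hy j trivial
  rw [lt_div_iff₀ (hz j), div_lt_iff₀ (hz j)]
  constructor
  · rcases le_or_gt ε 1 with h1 | h1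
    · exact (mul_le_mul_of_nonneg_left (hlu j).2 (by linarith)).trans_lt hyj.1
    · exact (mul_neg_of_neg_of_pos (by linarith) (hz j)).trans (y.2 j)
  · exact hyj.2.trans_le (mul_le_mul_of_nonneg_left (hlu j).1 (by linarith))

end Targets

/-! ### The time grid -/

section Grid

/-- The grid `0 < T/(2N), T/N, 2T/N, …, T`, without its first point. -/
noncomputable def shiftedGrid {T : ℝ} (hT : 0 < T) (N k : ℕ) : TimeInterval T :=
  ⟨min (max (k : ℝ) (1 / 2) * T / N) T, le_min (by positivity) hT.le, min_le_right _ _⟩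

theorem monotone_shiftedGrid {T : ℝ} (hT : 0 < T) (N : ℕ) : Monotone (shiftedGrid hT N) := by
  intro i j hij
  refine Subtype.coe_le_coe.1 (min_le_min_right T ?_)
  have : (i : ℝ) ≤ j := by exact_mod_cast hij
  gcongr

theorem coe_shiftedGrid {T : ℝ} (hT : 0 < T) {N k : ℕ} (hN : 0 < N) (hk : k ≤ N) :
    (shiftedGrid hT N k : ℝ) = max (k : ℝ) (1 / 2) * T / N := by
  have h1 : (1 : ℝ) ≤ N := by exact_mod_cast hN
  have hkN : (k : ℝ) ≤ N := by exact_mod_cast hk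
  refine min_eq_left ?_
  rw [div_le_iff₀ (by linarith), mul_comm]
  exact mul_le_mul_of_nonneg_left (max_le hkN (by linarith)) hT.le

theorem shiftedGrid_lt_succ {T : ℝ} (hT : 0 < T) {N k : ℕ} (hk : k < N) :
    shiftedGrid hT N k < shiftedGrid hT N (k + 1) := by
  have hN : 0 < N := (Nat.zero_le k).trans_lt hk
  have hN' : (0 : ℝ) < N := by exact_mod_cast hN
  rw [← Subtype.coe_lt_coe, coe_shiftedGrid hT hN hk.le, coe_shiftedGrid hT hN hk]
  have h0 : (0 : ℝ) ≤ k := k.cast_nonneg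
  have : max (k : ℝ) (1 / 2) < max ((k + 1 : ℕ) : ℝ) (1 / 2) := by
    push_cast
    exact lt_of_lt_of_le (max_lt (by linarith) (by linarith)) (le_max_left _ _)
  gcongr

theorem zero_lt_shiftedGrid {T : ℝ} (hT : 0 < T) {N : ℕ} (hN : 0 < N) (k : ℕ) :
    (⟨0, le_rfl, hT.le⟩ : TimeInterval T) < shiftedGrid hT N k := by
  have hN' : (0 : ℝ) < N := by exact_mod_cast hN
  exact lt_min (by positivity) hT

theorem gridTime_eq_shiftedGrid {T : ℝ} (hT : 0 < T) {N : ℕ} (hN : 0 < N) {k : Fin (N + 1)}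
    (hk : k ≠ 0) : gridTime hT N k = shiftedGrid hT N k := by
  ext1
  rw [coe_shiftedGrid hT hN (Nat.lt_succ_iff.1 k.2), max_eq_left]
  · rfl
  · have : (1 : ℝ) ≤ (k : ℕ) := by
      exact_mod_cast Nat.one_le_iff_ne_zero.2 (Fin.val_ne_zero_iff.2 hk)
    linarith

theorem gridTime_zero {T : ℝ} (hT : 0 < T) (N : ℕ) :
    gridTime hT N 0 = ⟨0, le_rfl, hT.le⟩ := by
  ext1
  simp [gridTime]

theorem gridTime_le_shiftedGrid {T : ℝ} (hT : 0 < T) {N : ℕ} (hN : 0 < N) (k : Fin (N + 1)) :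
    gridTime hT N k ≤ shiftedGrid hT N k := by
  rcases eq_or_ne k 0 with rfl | hk
  · rw [gridTime_zero]
    exact (zero_lt_shiftedGrid hT hN _).le
  · exact (gridTime_eq_shiftedGrid hT hN hk).le

end Grid

/-! ### Discrete data extracted from `M` -/

section AdmissibleMartingale

variable {Ω' : Type*} {mΩ' : MeasurableSpace Ω'} {μ : Measure Ω'} [IsProbabilityMeasure μ]
  {d N : ℕ} {s : Fin d → ℝ} {ε : ℝ} {M : Fin (N + 1) → Ω' → Fin d → ℝ}

theorem IsAdmissibleMartingale.exists_finite_coding (hM : IsAdmissibleMartingale μ s ε M) :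
    ∃ (I : Set (Fin d → ℝ)) (_ : I.Finite) (m : ℕ → Ω' → I), (∀ j, Measurable (m j)) ∧
      (∀ i : I, ∀ j, 0 < i.1 j) ∧ ∀ k ω, (m k ω : Fin d → ℝ) = M (Fin.ofNat (N + 1) k) ω := by
  refine ⟨⋃ k, Set.range (M k), Set.finite_iUnion hM.finite_range,
    fun k ω => ⟨M (Fin.ofNat (N + 1) k) ω, Set.mem_iUnion.2 ⟨_, ω, rfl⟩⟩,
    fun j => (hM.stronglyMeasurable _).measurable.subtype_mk, ?_, fun _ _ => rfl⟩
  rintro ⟨i, hi⟩ j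
  obtain ⟨k, ω, rfl⟩ := Set.mem_iUnion.1 hi
  exact hM.pos k ω j

/-- A history event up to `k` belongs to the natural filtration at `k`; integrating the martingale
property over it gives the identity. -/
theorem IsAdmissibleMartingale.sum_eq (hM : IsAdmissibleMartingale μ s ε M)
    {I : Set (Fin d → ℝ)} [Fintype I] {m : ℕ → Ω' → I} (hm : ∀ j, Measurable (m j))
    (hmM : ∀ k ω, (m k ω : Fin d → ℝ) = M (Fin.ofNat (N + 1) k) ω) (j : Fin d) {k : ℕ}
    (hk : k < N) (h : ℕ → I) :
    ∑ i : I, (i : Fin d → ℝ) j * μ.real (historyEvent m k h ∩ m (k + 1) ⁻¹' {i}) =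
      (h k : Fin d → ℝ) j * μ.real (historyEvent m k h) := by
  have hH := measurableSet_historyEvent (J := m) (k := k) (fun j _ => hm j) h
  rw [← setIntegral_comp_eq_sum (hm (k + 1)) (fun i : I => (i : Fin d → ℝ) j) hH]
  have hle {i i' : ℕ} (hi : i ≤ i') (hi' : i' ≤ N) :
      Fin.ofNat (N + 1) i ≤ Fin.ofNat (N + 1) i' := by
    rw [Fin.le_def]
    simp only [Fin.val_ofNat]
    rw [Nat.mod_eq_of_lt (by omega), Nat.mod_eq_of_lt (by omega)]
    exact hi
  have hnat : MeasurableSet[Filtration.natural M hM.stronglyMeasurable (Fin.ofNat (N + 1) k)]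
      (historyEvent m k h) := by
    have : historyEvent m k h =
        historyEvent (fun j => M (Fin.ofNat (N + 1) j)) k fun j => (h j : Fin d → ℝ) := by
      ext ω
      refine forall₂_congr fun j _ => ?_
      rw [Subtype.ext_iff, hmM]
    rw [this]
    refine measurableSet_historyEvent (fun j hj => ?_) _
    exact ((Filtration.stronglyAdapted_natural hM.stronglyMeasurable _).mono
      ((Filtration.natural M hM.stronglyMeasurable).mono (hle hj hk.le))).measurable
  have hmg := hM.martingale.setIntegral_eq (hle k.le_succ hk) hnat
  have hint (i : Fin (N + 1)) (j : Fin d) :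
      Integrable (fun ω => M i ω j) (μ.restrict (historyEvent m k h)) :=
    ((hM.martingale.integrable i).eval j).integrableOn
  have hj := congrFun hmg j
  rw [eval_integral (hint _), eval_integral (hint _)] at hj
  simp_rw [hmM]
  rw [← hj, setIntegral_congr_fun (g := fun _ => (h k : Fin d → ℝ) j) hH
    fun ω hω => by rw [← hω k le_rfl, hmM], setIntegral_const, smul_eq_mul, mul_comm]

theorem IsAdmissibleMartingale.step_of_measure_ne_zero (hM : IsAdmissibleMartingale μ s ε M)
    {I : Set (Fin d → ℝ)} {m : ℕ → Ω' → I}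
    (hmM : ∀ k ω, (m k ω : Fin d → ℝ) = M (Fin.ofNat (N + 1) k) ω) {k : ℕ}
    (hk : k < N) {h : ℕ → I} (hh : μ (historyEvent m (k + 1) h) ≠ 0) (j : Fin d) :
    (h (k + 1) : Fin d → ℝ) j ∈
      Set.Ioo ((1 - ε / 3) * (h k : Fin d → ℝ) j) ((1 + ε / 3) * (h k : Fin d → ℝ) j) := by
  by_contra hcon
  refine hh (measure_eq_zero_iff_ae_notMem.2 ?_)
  filter_upwards [hM.step ⟨k, hk⟩ j] with ω hω hmem
  have h1 : (⟨k, hk⟩ : Fin N).castSucc = Fin.ofNat (N + 1) k := by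
    ext
    simp [Nat.mod_eq_of_lt (show k < N + 1 by omega)]
  have h2 : (⟨k, hk⟩ : Fin N).succ = Fin.ofNat (N + 1) (k + 1) := by
    ext
    simp [Nat.mod_eq_of_lt (show k + 1 < N + 1 by omega)]
  rw [h1, h2, ← hmM, ← hmM, hmem k k.le_succ, hmem (k + 1) le_rfl] at hω
  exact hcon hω

end AdmissibleMartingale

/-! ### Assembly of the price system -/

theorem lemma3p2 {Ω : Type*} {mΩ : MeasurableSpace Ω} (P : Measure Ω) [IsProbabilityMeasure P]
    (hP : P.IsComplete) (d : ℕ) (T : ℝ) (hT : 0 < T)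
    (ℱ : Filtration (TimeInterval T) mΩ) (hℱ : UsualConditions P ℱ)
    (S : TimeInterval T → Ω → Orthant d)
    (hS_cont : ∀ ω, Continuous fun t => S t ω) (hS_adapted : Adapted ℱ S)
    (s : Fin d → ℝ) (hS_init : ∀ᵐ ω ∂P, (S ⟨0, le_rfl, hT.le⟩ ω : Fin d → ℝ) = s)
    (hCFS : ConditionalFullSupport P ℱ S hS_cont)
    (N : ℕ) (hN : 0 < N) (ε : ℝ) (hε : 0 < ε)
    {Ω' : Type*} {mΩ' : MeasurableSpace Ω'} (μ : Measure Ω') [IsProbabilityMeasure μ]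
    (M : Fin (N + 1) → Ω' → Fin d → ℝ) (hM : IsAdmissibleMartingale μ s ε M) :
    ∃ (Q : Measure Ω) (_ : IsProbabilityMeasure Q) (Shat : TimeInterval T → Ω → Fin d → ℝ),
      IsConsistentPriceSystem P ℱ S ε Shat Q ∧
      Q.map (fun ω k => Shat (gridTime hT N k) ω) = μ.map (fun ω k => M k ω) ∧
      ∀ k : Fin N, ∀ᵐ ω ∂Q,
        condLaw Q (ℱ (gridTime hT N k.castSucc)) (Shat (gridTime hT N k.succ)) ω =
          condDistrib (Shat (gridTime hT N k.succ))
            (history (fun j => Shat (gridTime hT N j)) k.castSucc) Q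
            (history (fun j => Shat (gridTime hT N j)) k.castSucc ω) := by
  obtain ⟨I, hI, m, hm, hpos, hmM⟩ := hM.exists_finite_coding
  have : Fintype I := hI.fintype
  have hm0 : ∀ᵐ ω ∂μ, (m 0 ω : Fin d → ℝ) = s := by
    filter_upwards [hM.init] with ω hω
    rw [hmM, ← hω]
    rfl
  obtain ⟨i₀, hi₀⟩ : ∃ i₀ : I, (i₀ : Fin d → ℝ) = s := ⟨_, hm0.exists.choose_spec⟩
  have hspos (j : Fin d) : 0 < s j := hi₀ ▸ hpos i₀ j
  obtain ⟨y, l, u, hy, hl, hyU, hyU₀, hstep⟩ :=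
    exists_targets hε (x := fun i : I => (i : Fin d → ℝ)) Subtype.val_injective hpos
  obtain ⟨c, hc, hcx⟩ := exists_pos_forall_le_of_finite
    (f := fun p : I × Fin d => (p.1 : Fin d → ℝ) p.2) (fun p => hpos p.1 p.2)
  obtain ⟨B, hB⟩ := (Set.finite_range fun p : I × Fin d => (p.1 : Fin d → ℝ) p.2).bddAbove
  have hxb (i : I) (j : Fin d) : (i : Fin d → ℝ) j ∈ Set.Icc c (max c B) :=
    ⟨hcx (i, j), (hB ⟨(i, j), rfl⟩).trans (le_max_right _ _)⟩
  let y' : I → Fin d → ℝ := fun i => (y i : Fin d → ℝ)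
  have hy' : Function.Injective y' := Subtype.val_injective.comp hy
  -- Disjoint neighbourhoods of the finitely many distinct target points keep the targets apart, so
  -- the state can be read off from `S`.
  obtain ⟨W, hW, hWdisj⟩ := (Set.finite_range y').t2_separation
  let U : I → Set (Fin d → ℝ) := fun i => openBox ε (l i) (u i)
  let V : I → Set (Fin d → ℝ) := fun i => W (y' i) ∩ U i
  have hVo (i : I) : IsOpen (V i) := (hW _).2.inter (isOpen_openBox _ _ _)
  have hyV (i : I) : y' i ∈ V i := ⟨(hW _).1, fun j _ => hyU i j⟩
  obtain ⟨r, hr, hrV⟩ := exists_measurable_selector i₀ hVo fun i i' hii =>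
    (hWdisj ⟨i, rfl⟩ ⟨i', rfl⟩ (hy'.ne hii)).mono Set.inter_subset_left Set.inter_subset_left
  -- Since `τ 0 = T / (2N)`, the interval `[0, τ 0]` is free for moving `S` from `s` to the target
  -- of `i₀`, a different point when `ε > 1` and the values are rescaled by a factor below 1. For `1
  -- ≤ k ≤ N`, `τ k` is the true grid time.
  let τ := shiftedGrid hT N
  have hτ : Monotone τ := monotone_shiftedGrid hT N
  let J : ℕ → Ω → I := fun k ω => r (S (τ k) ω)
  have hJ (k : ℕ) : Measurable[ℱ (τ k)] (J k) :=
    hr.comp (measurable_subtype_coe.comp (hS_adapted (τ k)))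
  have hJ' (k : ℕ) : Measurable (J k) := (hJ k).mono (ℱ.le _) le_rfl
  have hJV (k : ℕ) (ω : Ω) (i : I) (h : (S (τ k) ω : Fin d → ℝ) ∈ V i) : J k ω = i := hrV i _ h
  have hm0' : ∀ᵐ ω ∂μ, m 0 ω = i₀ := hm0.mono fun ω hω => Subtype.ext (hω.trans hi₀.symm)
  obtain ⟨Z₀, hZ₀, hZ₀P, hZ₀tube⟩ := exists_initial_embedding (U := U) (U₀ := openBox ε s s) hCFS
    hS_adapted (zero_lt_shiftedGrid hT hN 0) hS_init (isOpen_openBox _ _ _) (convex_openBox _ _ _)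
    (fun j _ => by
      have := mul_pos hε (hspos j)
      constructor <;> linarith)
    (hVo i₀) ⟨y i₀, fun j _ => by simpa only [hi₀] using hyU₀ i₀ j, hyV i₀⟩ (hJV 0) hm0'
  obtain ⟨Z, hZ⟩ := hZ₀.exists_of_zero hCFS hS_adapted hτ (fun i => isOpen_openBox _ _ _)
    (fun i => convex_openBox _ _ _) hVo (fun i => Set.inter_subset_right) hJ hJV hm
    (fun k hk => shiftedGrid_lt_succ hT hk)
    (fun k hk h hh => ⟨y (h (k + 1)), fun j _ =>
      (hstep _ _ (hM.step_of_measure_ne_zero hmM hk hh) j).2, hyV _⟩)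
  have hprob := hZ.isProbabilityMeasure hJ' hm
  have hJ₀ : ∀ᵐ ω ∂P.withDensity Z, (J 0 ω : Fin d → ℝ) = s := by
    have h0 := hZ.law_of_le hJ' hm N.zero_le fun _ => i₀
    have h1 : μ (historyEvent m 0 fun _ => i₀) = 1 := by
      rw [← measure_univ (μ := μ)]
      refine measure_congr (hm0'.mono fun ω hω => propext (iff_true_intro fun j hj => ?_))
      rw [Nat.le_zero.1 hj, hω]
    rw [h1] at h0
    have h2 := (mem_ae_iff_prob_eq_one
      (measurableSet_historyEvent (fun j _ => hJ' j) fun _ => i₀)).2 h0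
    filter_upwards [h2] with ω hω
    rw [← hi₀, hω 0 le_rfl]
  obtain ⟨Shat, hCPS, hgrid, hinit⟩ := hZ.exists_priceSystem (ℱ := ℱ) hℱ.rightContinuous hZ₀P hJ hm
    hτ (fun t => by
      rw [← Subtype.coe_le_coe, coe_shiftedGrid hT hN le_rfl, max_eq_left,
        mul_div_cancel_left₀ _ (by exact_mod_cast hN.ne')]
      · exact t.2.2
      · have : (1 : ℝ) ≤ N := by exact_mod_cast hN
        linarith)
    (t₀ := ⟨0, le_rfl, hT.le⟩) (fun t => t.2.1) hN hc (le_max_left c B) hxb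
    (fun j k hk h => hM.sum_eq hm hmM j hk h)
    (fun k hk h hh j => (hstep _ _ (hM.step_of_measure_ne_zero hmM hk hh) j).1) hJ₀
    (fun i z hz w hw hwl j => div_mem_of_mem_openBox hε hz hw hwl j)
    (fun z hz j => div_mem_of_mem_openBox hε hz hspos (fun j => ⟨le_rfl, le_rfl⟩) j) hZ₀tube
  -- The grids differ only at `k = 0`; there the price is constantly `s` up to `τ 0`, so its value
  -- at time 0 is still that of `J 0`.
  have hgridTime (k : Fin (N + 1)) :
      ∀ᵐ ω ∂P.withDensity Z, Shat (gridTime hT N k) ω = (J k ω : Fin d → ℝ) := by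
    rcases eq_or_ne k 0 with rfl | hk
    · filter_upwards [hinit _ (gridTime_le_shiftedGrid hT hN 0), hJ₀] with ω h1 h2
      rw [h1]
      exact h2.symm
    · rw [gridTime_eq_shiftedGrid hT hN hk]
      exact hgrid k (Nat.lt_succ_iff.1 k.2)
  refine ⟨P.withDensity Z, hprob, Shat, hCPS, ?_, fun k => ?_⟩
  · have hval : Measurable fun (v : Fin (N + 1) → I) k => (v k : Fin d → ℝ) :=
      measurable_of_countable _
    have h1 : (fun ω k => Shat (gridTime hT N k) ω) =ᵐ[P.withDensity Z]
        (fun v k => (v k : Fin d → ℝ)) ∘ fun ω (k : Fin (N + 1)) => J k ω := by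
      filter_upwards [ae_all_iff.2 hgridTime] with ω hω using funext hω
    have h2 : (fun ω k => M k ω) =
        (fun v k => (v k : Fin d → ℝ)) ∘ fun ω (k : Fin (N + 1)) => m k ω := by
      funext ω k
      simp [hmM]
    rw [Measure.map_congr h1, h2, ← Measure.map_map hval (measurable_pi_lambda _ fun k => hJ' k),
      ← Measure.map_map hval (measurable_pi_lambda _ fun k => hm k), hZ.map_eq hJ' hm]
  · have hadapted (j : Fin (N + 1)) (hj : j ≤ k.castSucc) :
        Measurable[ℱ (gridTime hT N k.castSucc)] (Shat (gridTime hT N j)) := by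
      refine (hCPS.martingale.1 _).measurable.mono (ℱ.mono ?_) le_rfl
      have : ((j : ℕ) : ℝ) ≤ ((k.castSucc : Fin (N + 1)) : ℕ) := by exact_mod_cast hj
      rw [← Subtype.coe_le_coe]
      simp only [gridTime]
      gcongr
    refine hZ.condLaw_eq (x := fun i : I => (i : Fin d → ℝ))
      (b := fun h (j : Set.Iic k.castSucc) => (h j.1 : Fin d → ℝ)) hJ hm k.2
      (ℱ.mono (gridTime_le_shiftedGrid hT hN k.castSucc)) ?_ ?_ ?_ ?_ ?_
    · exact @measurable_pi_lambda Ω (Set.Iic k.castSucc) (fun _ => Fin d → ℝ)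
        (ℱ (gridTime hT N k.castSucc)) _ _ fun j => hadapted j.1 j.2
    · exact ((hCPS.martingale.1 _).mono (ℱ.le _)).measurable
    · exact hgridTime k.succ
    · intro h h'
      refine ⟨fun hh j hj => ?_, fun hh => funext fun j => ?_⟩
      · have hj' : j < N + 1 := by omega
        exact Subtype.ext (congrFun hh ⟨⟨j, hj'⟩, hj⟩)
      · exact congrArg Subtype.val (hh _ j.2)
    · filter_upwards [ae_all_iff.2 hgridTime] with ω hω
      exact funext fun j => hω j.1
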